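/- Let $k$ be a number field of degree $m=[k:\mathbb{Q}]$ with a fixed algebraic closure $\overline{k}$, and let $e>1$ be an integer. Let $H$ be the absolute non-logarithmic Weil height on $\mathbb{P}^n(\overline{k})$ (maximum norm at every place); $H(1,\alpha)$ is the height of $(1:\alpha)\in\mathbb{P}^1(\overline{k})$. For $P=(\alpha_0:\dots:\alpha_n)$ let $k(P)$ be the field generated over $k$ by all ratios $\alpha_i/\alpha_j$ with $\alpha_j\neq 0$. Put $$Z(X)=\bigl|\{P\in\mathbb{P}^1(\overline{k}) : [k(P):k]=e,\ H(P)\le X\}\bigr| .$$ For a field $K$ with $k\subseteq K\subseteq\overline{k}$ and $[K:k]=e$ let $\delta(K/k)=\inf\{H(1,\alpha): K=k(\alpha)\}$, and let $N_\delta(T)$ be the number of such fields $K$ with $\delta(K/k)\le T$. (1) There are real numbers $c>0$ and $X_0$, depending only on $k$ and $e$, with $$c\,X^{me(e+1)}\le Z(X)\quad\text{for all } X\ge X_0, \tag{a}$$ and whenever $c>0$ and $X_0$ satisfy (a), then, with $c_\delta=2^{-5em-22}c$ and $T_0=X_0$, $$c_\delta\,T^{me(e-1)}\le N_\delta(T)\quad\text{for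 all } T\ge T_0 .$$ (2) There is a constant $C>0$ with $$Z(X)\le C\,X^{me(e+1)}\quad\text{for all } X\ge 0 \tag{b}$$ (in particular $Z(X)$ is finite); one can take $C=2^{me(e+4)+e^2+10e+11}$. Whenever $C>0$ satisfies (b), then $N_\delta(T)$ is finite and, with $C_\delta=C$, $$N_\delta(T)\le C_\delta\,T^{me(e+1)}\quad\text{for all } T>0 .$$ -/

import Mathlib

noncomputable section

namespace WidmerCount

/-- Finitely many elements of an algebraic closure of a number field `k` generate
a number field over `k`. -/
theorem numberField_adjoin_range (k : Type*) {kbar : Type*} [Field k] [NumberField k] [Field kbar]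
    [Algebra k kbar] [IsAlgClosure k kbar] {ι : Type*} [Finite ι] (x : ι → kbar) :
    NumberField (IntermediateField.adjoin k (Set.range x)) := by
  have : Algebra.IsAlgebraic k kbar := IsAlgClosure.isAlgebraic
  have : FiniteDimensional k (IntermediateField.adjoin k (Set.range x)) :=
    IntermediateField.finiteDimensional_adjoin
      (fun y _ => (Algebra.IsAlgebraic.isAlgebraic (R := k) y).isIntegral)
  exact NumberField.of_module_finite k _

/-- The absolute (non-logarithmic) Weil height of a nonzero tuple `x` of elements of `kbar`:
`H(x) = ∏_v max_i |x_i|_v ^ (d_v / d)`, the product over all places `v` of the number field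
`L = k(x_0, …, x_n)` of degree `d` over `ℚ`. Mathlib's `Height.mulHeight` over `L` is the relative
height `∏_v max_i |x_i|_v ^ d_v`, so that its `d`-th root is taken. -/
def absHeight (k : Type*) {kbar : Type*} [Field k] [NumberField k] [Field kbar]
    [Algebra k kbar] [IsAlgClosure k kbar] {n : ℕ} (x : Fin (n + 1) → kbar) : ℝ :=
  haveI : NumberField (IntermediateField.adjoin k (Set.range x)) := numberField_adjoin_range k x
  (Height.mulHeight (fun i => (⟨x i, IntermediateField.subset_adjoin k _ (Set.mem_range_self i)⟩ :
      IntermediateField.adjoin k (Set.range x)))) ^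
    ((Module.finrank ℚ (IntermediateField.adjoin k (Set.range x)) : ℝ)⁻¹)

/-- Projective space `ℙⁿ(kbar)`. -/
abbrev ProjSpace (kbar : Type*) [Field kbar] (n : ℕ) : Type _ :=
  Projectivization kbar (Fin (n + 1) → kbar)

/-- The absolute Weil height of a projective point (it is the same for all
representatives of the point). -/
def projHeight (k : Type*) {kbar : Type*} [Field k] [NumberField k] [Field kbar]
    [Algebra k kbar] [IsAlgClosure k kbar] {n : ℕ} (P : ProjSpace kbar n) : ℝ :=
  absHeight k P.rep

/-- The field `k(P)` generated over `k` by all ratios `x_i / x_j` (`x_j ≠ 0`) of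
coordinates of `P`. -/
def fieldOfPoint (k : Type*) {kbar : Type*} [Field k] [Field kbar]
    [Algebra k kbar] {n : ℕ} (P : ProjSpace kbar n) : IntermediateField k kbar :=
  IntermediateField.adjoin k {a | ∃ i j, P.rep j ≠ 0 ∧ a = P.rep i / P.rep j}

/-- The set `{P ∈ ℙⁿ(kbar) : [k(P) : k] = e, H(P) ≤ X}`. -/
def pointsOfDegree (k kbar : Type*) [Field k] [NumberField k] [Field kbar]
    [Algebra k kbar] [IsAlgClosure k kbar] (n e : ℕ) (X : ℝ) : Set (ProjSpace kbar n) :=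
  {P | Module.finrank k (fieldOfPoint k P) = e ∧ projHeight k P ≤ X}

/-- `c` and `X₀` are admissible constants in the lower bound
`c X^{m e (max{e,n}+1)} ≤ Z_H(ℙⁿ(k;e), X)` for all `X ≥ X₀`, where `m = [k : ℚ]`. -/
def IsSchmidtLower (k kbar : Type*) [Field k] [NumberField k] [Field kbar]
    [Algebra k kbar] [IsAlgClosure k kbar] (e n : ℕ) (c X₀ : ℝ) : Prop :=
  0 < c ∧ ∀ X : ℝ, X₀ ≤ X →
    c * X ^ (Module.finrank ℚ k * e * (max e n + 1)) ≤ ((pointsOfDegree k kbar n e X).ncard : ℝ)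

/-- `C` is an admissible constant in the upper bound
`Z_H(ℙⁿ(k;e), X) ≤ C X^{m e (e+n)}` for all `X ≥ 0`, where `m = [k : ℚ]`. -/
def IsSchmidtUpper (k kbar : Type*) [Field k] [NumberField k] [Field kbar]
    [Algebra k kbar] [IsAlgClosure k kbar] (e n : ℕ) (C : ℝ) : Prop :=
  0 < C ∧ ∀ X : ℝ, 0 ≤ X → (pointsOfDegree k kbar n e X).Finite ∧
    ((pointsOfDegree k kbar n e X).ncard : ℝ) ≤ C * X ^ (Module.finrank ℚ k * e * (e + n))

/-- The explicit constant `2^{m e (e+n+3) + e² + n² + 10 e + 10 n}`. -/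
def schmidtConst (m e n : ℕ) : ℝ :=
  2 ^ (m * e * (e + n + 3) + e ^ 2 + n ^ 2 + 10 * e + 10 * n)

/-- `δ(K/k) = inf {H(1, α) : K = k(α)}`. -/
def delta (k : Type*) {kbar : Type*} [Field k] [NumberField k] [Field kbar]
    [Algebra k kbar] [IsAlgClosure k kbar] (K : IntermediateField k kbar) : ℝ :=
  sInf {h | ∃ α : kbar, K = IntermediateField.adjoin k {α} ∧ h = absHeight k ![1, α]}

/-- The set of extensions `K` of `k` in `kbar` with `[K : k] = e` and `δ(K/k) ≤ T`. -/
def fieldsOfDegree (k kbar : Type*) [Field k] [NumberField k] [Field kbar]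
    [Algebra k kbar] [IsAlgClosure k kbar] (e : ℕ) (T : ℝ) : Set (IntermediateField k kbar) :=
  {K | Module.finrank k K = e ∧ delta k K ≤ T}

/-- The counting function `N_δ(T)`. -/
def Ndelta (k kbar : Type*) [Field k] [NumberField k] [Field kbar]
    [Algebra k kbar] [IsAlgClosure k kbar] (e : ℕ) (T : ℝ) : ℕ :=
  (fieldsOfDegree k kbar e T).ncard

end WidmerCount

end

/-! Upper bound for Z. A point of degree e > 1 is (1 : α), and sending α to the coefficients of its
minimal polynomial is at most e-to-one. By `mulHeight_minpoly_le_and_le` the image consists of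
tuples over k with last entry 1 and relative height at most W = (2X)^(em): Gauss's lemma loses
nothing at finite places, and Mahler measure loses only a constant at infinite ones.
`card_affine_le` bounds the number of such tuples by a constant times W^(e+1), adding one coordinate
at a time. If t ≠ u both extend x to height at most W, the product formula for t - u keeps t and u
apart at the infinite places: the product of their chordal distances is at least H(x)/W². A
pigeonhole argument then leaves at most 8^m W²/H(x) extensions, and a dyadic summation over x closes
the induction.

Lower bound for Z. Eisenstein polynomials over the integers of k with coefficients of size O(N)
number at least N^(m(e+1)); each root has degree e over k and height O(N^(1/e)). Polynomials with a
common root are proportional, `card_proportional_pairs_le` shows that there are only O(N^(m(e+1)))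
proportional pairs, and Cauchy-Schwarz yields on the order of N^(m(e+1)) distinct roots.

Fields. For T' > T each field counted by N_δ(T) has a generator of height at most T', so N_δ(T) is
at most Z(T'), and T' tends to T. Conversely, each number counted by Z(T) generates a field counted
by N_δ(T), and a field of degree me over ℚ has at most 8^(me) T^(2me) elements of height at most T.
Dividing lowers the exponent from me(e+1) to me(e-1). -/

/-! ### Weil heights: base change, scaling and conjugation. -/

noncomputable section

namespace WidmerCount

open NumberField Module

/-- A product over infinite places with multiplicities is a product over embeddings. -/
theorem prod_infinitePlace_pow_mult {K : Type*} [Field K] [NumberField K]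
    (F : InfinitePlace K → ℝ) :
    ∏ v : InfinitePlace K, F v ^ v.mult = ∏ φ : K →+* ℂ, F (InfinitePlace.mk φ) := by
  classical
  rw [← Finset.prod_fiberwise (s := Finset.univ) (g := fun φ : K →+* ℂ => InfinitePlace.mk φ)]
  refine Finset.prod_congr rfl fun v _ => ?_
  rw [← InfinitePlace.card_filter_mk_eq v, ← Finset.prod_const]
  refine Finset.prod_congr rfl fun φ hφ => ?_
  rw [(Finset.mem_filter.mp hφ).2]

/-- Every embedding of `K` has exactly `[L : K]` extensions to `L`. -/
theorem card_embeddings_extending {K L : Type*} [Field K] [NumberField K] [Field L] [NumberField L]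
    [Algebra K L] [DecidableEq (K →+* ℂ)] (φ : K →+* ℂ) :
    (Finset.univ.filter fun ψ : L →+* ℂ => ψ.comp (algebraMap K L) = φ).card = finrank K L := by
  let _ : Algebra K ℂ := φ.toAlgebra
  have : FiniteDimensional K L := Module.Finite.of_restrictScalars_finite ℚ K L
  rw [← AlgHom.card K L ℂ, Fintype.card, ← Finset.card_map ⟨fun f : L →ₐ[K] ℂ => (f : L →+* ℂ),
    fun f g h => AlgHom.coe_ringHom_injective h⟩]
  congr 1
  ext ψ
  simp only [Finset.mem_filter, Finset.mem_univ, true_and, Finset.mem_map]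
  constructor
  · intro h
    exact ⟨AlgHom.mk ψ fun r => RingHom.congr_fun h r, rfl⟩
  · rintro ⟨f, rfl⟩
    ext x
    exact f.commutes x

/-- Over embeddings instead of places no multiplicities remain, and the embeddings of L are grouped
by their restriction to K, with [L : K] in each group. -/
theorem prod_infinitePlace_algebraMap {K L ι : Type*} [Field K] [NumberField K] [Field L]
    [NumberField L] [Algebra K L] (x : ι → K) :
    ∏ w : InfinitePlace L, (⨆ i, w (algebraMap K L (x i))) ^ w.mult =
      (∏ v : InfinitePlace K, (⨆ i, v (x i)) ^ v.mult) ^ finrank K L := by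
  classical
  rw [prod_infinitePlace_pow_mult (K := L) fun w => ⨆ i, w (algebraMap K L (x i)),
    prod_infinitePlace_pow_mult (K := K) fun v => ⨆ i, v (x i),
    ← Finset.prod_fiberwise (s := Finset.univ)
      (g := fun ψ : L →+* ℂ => ψ.comp (algebraMap K L)), ← Finset.prod_pow]
  refine Finset.prod_congr rfl fun φ _ => ?_
  rw [← card_embeddings_extending (L := L) φ, ← Finset.prod_const]
  refine Finset.prod_congr rfl fun ψ hψ => ?_
  rw [← (Finset.mem_filter.mp hψ).2]
  rfl

/-- For integral coordinates the finite part of the height is the inverse norm of the ideal they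
generate. This turns base change of the finite part into base change of ideal norms. -/
theorem mulHeight_integral_mul_absNorm {K ι : Type*} [Field K] [NumberField K] [Finite ι]
    {y : ι → 𝓞 K} (hy : y ≠ 0) :
    Height.mulHeight (fun i => (y i : K)) * (Ideal.span (Set.range y)).absNorm =
      ∏ v : InfinitePlace K, (⨆ i, v (y i : K)) ^ v.mult := by
  have hy' : (fun i => (y i : K)) ≠ 0 := by
    obtain ⟨i, hi⟩ := Function.ne_iff.mp hy
    exact Function.ne_iff.mpr ⟨i, by simpa using hi⟩
  rw [NumberField.mulHeight_eq hy', mul_assoc, mul_comm (∏ᶠ _, _),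
    absNorm_mul_finprod_finitePlace_eq_one hy, mul_one]

theorem exists_integral_smul {K ι : Type*} [Field K] [NumberField K] [Finite ι] (x : ι → K) :
    ∃ (c : K) (y : ι → 𝓞 K), c ≠ 0 ∧ c • x = fun i => (y i : K) := by
  obtain ⟨b, hb⟩ := IsLocalization.exist_integer_multiples_of_finite (nonZeroDivisors (𝓞 K)) x
  choose y hy using hb
  refine ⟨(b : 𝓞 K), y, ?_, ?_⟩
  · simp
  · ext i
    exact (Algebra.smul_def _ _).symm.trans (hy i).symm

/-- The relative height of a tuple is raised to the power `[L : K]` in an extension `L / K`. -/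
theorem mulHeight_algebraMap {K L ι : Type*} [Field K] [NumberField K] [Field L] [NumberField L]
    [Algebra K L] [Finite ι] (x : ι → K) :
    Height.mulHeight (fun i => algebraMap K L (x i)) = Height.mulHeight x ^ finrank K L := by
  rcases eq_or_ne x 0 with rfl | hx
  · simp [show (fun _ : ι => (0 : L)) = 0 from rfl]
  obtain ⟨c, y, hc, hcy⟩ := exists_integral_smul x
  have hc' : algebraMap K L c ≠ 0 := by simpa using hc
  have hy : y ≠ 0 := by
    rintro rfl
    apply hx
    have : c • x = 0 := by rw [hcy]; ext; simp
    exact (smul_eq_zero.mp this).resolve_left hc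
  let z : ι → 𝓞 L := fun i => algebraMap (𝓞 K) (𝓞 L) (y i)
  have hz : z ≠ 0 := by
    obtain ⟨i, hi⟩ := Function.ne_iff.mp hy
    refine Function.ne_iff.mpr ⟨i, ?_⟩
    simpa [z] using hi
  have hzy : ∀ i, (z i : L) = algebraMap K L (y i) := fun i => rfl
  -- Scaling makes the tuple integral without changing its height; then the ideal norm and the
  -- archimedean product are both raised to the power [L : K] when passing to L.
  rw [← Height.mulHeight_smul_eq_mulHeight x hc, hcy,
    ← Height.mulHeight_smul_eq_mulHeight (fun i => algebraMap K L (x i)) hc']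
  have h1 : algebraMap K L c • (fun i => algebraMap K L (x i)) = fun i => (z i : L) := by
    ext i
    rw [hzy, ← congrFun hcy i]
    simp
  rw [h1]
  have hzspan : (Ideal.span (Set.range z)) = (Ideal.span (Set.range y)).map
      (algebraMap (𝓞 K) (𝓞 L)) := by
    rw [Ideal.map_span, ← Set.range_comp]
    rfl
  have hL := mulHeight_integral_mul_absNorm hz
  have hK := mulHeight_integral_mul_absNorm hy
  have hrank : finrank (𝓞 K) (𝓞 L) = finrank K L :=
    (IsFractionRing.finrank_eq (𝓞 K) K (𝓞 L) L).symm
  simp_rw [hzy] at hL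
  rw [hzspan, Ideal.absNorm_algebraMap, hrank, prod_infinitePlace_algebraMap, ← hK, mul_pow,
    Nat.cast_pow] at hL
  have hne : ((Ideal.span (Set.range y)).absNorm : ℝ) ≠ 0 := by
    rw [Nat.cast_ne_zero, Ne, Ideal.absNorm_eq_zero_iff, Ideal.span_eq_bot]
    intro h
    exact hy (funext fun i => h _ ⟨i, rfl⟩)
  exact mul_right_cancel₀ (pow_ne_zero _ hne) hL

/-- The absolute height can be computed in any number field containing the coordinates. -/
theorem absHeight_pow {k kbar L : Type*} [Field k] [NumberField k] [Field kbar] [Algebra k kbar]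
    [IsAlgClosure k kbar] [Field L] [NumberField L] [Algebra k L] (φ : L →ₐ[k] kbar) {n : ℕ}
    (x : Fin (n + 1) → L) :
    absHeight k (fun i => φ (x i)) ^ finrank ℚ L = Height.mulHeight x := by
  set F := IntermediateField.adjoin k (Set.range fun i => φ (x i)) with hF
  have : NumberField F := numberField_adjoin_range k _
  have hle : F ≤ φ.fieldRange := by
    rw [hF, IntermediateField.adjoin_le_iff]
    rintro _ ⟨i, rfl⟩
    exact ⟨x i, rfl⟩
  let e : L ≃ₐ[k] φ.fieldRange := AlgEquiv.ofInjectiveField φ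
  -- The field generated by the coordinates lies in the image of φ, so the inverse of φ makes L an
  -- extension of it and base change applies.
  let j : F →ₐ[k] L := e.symm.toAlgHom.comp (IntermediateField.inclusion hle)
  let _ : Algebra F L := j.toRingHom.toAlgebra
  let y : Fin (n + 1) → F := fun i =>
    ⟨φ (x i), IntermediateField.subset_adjoin k _ (Set.mem_range_self i)⟩
  have hy : (fun i => algebraMap F L (y i)) = x := by
    ext i
    change e.symm _ = x i
    rw [AlgEquiv.symm_apply_eq]
    rfl
  have hmul := mulHeight_algebraMap (L := L) y
  rw [hy] at hmul
  have hdeg : finrank ℚ F * finrank F L = finrank ℚ L := finrank_mul_finrank ℚ F L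
  have habs : absHeight k (fun i => φ (x i)) =
      Height.mulHeight y ^ ((finrank ℚ F : ℝ)⁻¹) := rfl
  rw [hmul, habs, ← hdeg, pow_mul, Real.rpow_inv_natCast_pow (Height.mulHeight_pos y).le
    (finrank_pos).ne']

theorem one_le_absHeight {k kbar : Type*} [Field k] [NumberField k] [Field kbar] [Algebra k kbar]
    [IsAlgClosure k kbar] {n : ℕ} (x : Fin (n + 1) → kbar) : 1 ≤ absHeight k x :=
  have := numberField_adjoin_range k x
  Real.one_le_rpow (Height.one_le_mulHeight _) (by positivity)

/-- Scaling may change the field generated by the coordinates, so both heights are computed in one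
number field that also contains c. -/
theorem absHeight_smul {k kbar : Type*} [Field k] [NumberField k] [Field kbar] [Algebra k kbar]
    [IsAlgClosure k kbar] {n : ℕ} (x : Fin (n + 1) → kbar) {c : kbar} (hc : c ≠ 0) :
    absHeight k (c • x) = absHeight k x := by
  let z : Fin (n + 2) → kbar := Fin.cons c x
  let L := IntermediateField.adjoin k (Set.range z)
  have : NumberField L := numberField_adjoin_range k z
  have hmem : ∀ i, z i ∈ L := fun i => IntermediateField.subset_adjoin k _ ⟨i, rfl⟩
  let c' : L := ⟨c, hmem 0⟩
  let x' : Fin (n + 1) → L := fun i => ⟨x i, hmem i.succ⟩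
  have h1 := absHeight_pow (IntermediateField.val L) x'
  have h2 := absHeight_pow (IntermediateField.val L) (c' • x')
  rw [Height.mulHeight_smul_eq_mulHeight _ (by simpa [c', Subtype.ext_iff] using hc), ← h1] at h2
  exact (pow_left_inj₀ (zero_le_one.trans (one_le_absHeight _))
    (zero_le_one.trans (one_le_absHeight _)) finrank_pos.ne').mp h2

/-- Conjugate elements have the same absolute height. -/
theorem absHeight_eq_of_minpoly_eq {k kbar : Type*} [Field k] [NumberField k] [Field kbar]
    [Algebra k kbar] [IsAlgClosure k kbar] {a b : kbar} (h : minpoly k a = minpoly k b) :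
    absHeight k ![1, a] = absHeight k ![1, b] := by
  have : Algebra.IsAlgebraic k kbar := IsAlgClosure.isAlgebraic
  have ha : IsIntegral k a := Algebra.IsIntegral.isIntegral a
  have hb : IsIntegral k b := Algebra.IsIntegral.isIntegral b
  let L := IntermediateField.adjoin k {a}
  have : FiniteDimensional k L := IntermediateField.adjoin.finiteDimensional ha
  have : NumberField L := NumberField.of_module_finite k L
  let g : L := IntermediateField.AdjoinSimple.gen k a
  have hroot : Polynomial.aeval b (minpoly k (IntermediateField.adjoin.powerBasis ha).gen) = 0 := by
    rw [IntermediateField.adjoin.powerBasis_gen, IntermediateField.minpoly_gen, h, minpoly.aeval]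
  -- The heights of a and b are the height of one element of k(a), seen through two k-embeddings
  -- into `kbar`.
  let φ : L →ₐ[k] kbar := (IntermediateField.adjoin.powerBasis ha).lift b hroot
  have hφ : φ g = b := (IntermediateField.adjoin.powerBasis ha).lift_gen b hroot
  have h1 := absHeight_pow (IntermediateField.val L) ![1, g]
  have h2 := absHeight_pow φ ![1, g]
  have e1 : (fun i => IntermediateField.val L (![1, g] i)) = ![1, a] := by
    ext i; fin_cases i <;> simp [g]
  have e2 : (fun i => φ (![1, g] i)) = ![1, b] := by
    ext i; fin_cases i <;> simp [hφ]
  rw [e1] at h1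
  rw [e2, ← h1] at h2
  exact ((pow_left_inj₀ (zero_le_one.trans (one_le_absHeight _))
    (zero_le_one.trans (one_le_absHeight _)) finrank_pos.ne').mp h2).symm

/-- The absolute height of an algebraic number, computed in a number field containing it. -/
theorem absHeight_one_pow {k kbar L : Type*} [Field k] [NumberField k] [Field kbar]
    [Algebra k kbar] [IsAlgClosure k kbar] [Field L] [NumberField L] [Algebra k L]
    (φ : L →ₐ[k] kbar) (a : L) :
    absHeight k ![1, φ a] ^ finrank ℚ L = Height.mulHeight₁ a := by
  have h := absHeight_pow φ ![1, a]
  have e : (fun i => φ (![1, a] i)) = ![1, φ a] := by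
    ext i; fin_cases i <;> simp
  rw [e] at h
  rw [h, Height.mulHeight₁_eq_mulHeight, Height.mulHeight_swap]

end WidmerCount

end


/-! ### Height of a polynomial against the heights of its roots. -/

noncomputable section

namespace WidmerCount

open NumberField Module Polynomial

theorem natDegree_prod_X_sub_C' {K ι : Type*} [Field K] [Fintype ι] (a : ι → K) :
    (∏ i, (X - C (a i))).natDegree = Fintype.card ι := by
  rw [natDegree_prod_of_monic _ _ fun i _ => monic_X_sub_C _]
  simp

theorem mahlerMeasure_prod_X_sub_C {ι : Type*} [Fintype ι] (z : ι → ℂ) :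
    (∏ i, (X - C (z i))).mahlerMeasure = ∏ i, max ‖z i‖ 1 := by
  classical
  refine Finset.induction_on (Finset.univ : Finset ι) (by simp) fun i s hi ih => ?_
  rw [Finset.prod_insert hi, Finset.prod_insert hi, mahlerMeasure_mul, ih, mahlerMeasure_X_sub_C,
    max_comm]

/-- Gauss's lemma: the Gauss norm is multiplicative, so the finite places contribute no constant to
the comparison. -/
theorem gaussNorm_prod_X_sub_C {K ι : Type*} [Field K] [Fintype ι] {v : AbsoluteValue K ℝ}
    (hv : IsNonarchimedean v) (a : ι → K) :
    (∏ i, (X - C (a i))).gaussNorm v 1 = ∏ i, max (v (a i)) 1 := by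
  classical
  refine Finset.induction_on (Finset.univ : Finset ι) ?_ fun i s hi ih => ?_
  · simpa using gaussNorm_C v 1 (1 : K)
  rw [Finset.prod_insert hi, Finset.prod_insert hi, gaussNorm_mul hv one_pos, ih]
  congr 1
  refine le_antisymm ?_ (max_le ?_ ?_)
  · obtain ⟨j, hj⟩ := exists_eq_gaussNorm v 1 (X - C (a i))
    rw [hj, one_pow, mul_one, coeff_sub, coeff_X, coeff_C]
    rcases j with _ | _ | j <;> simp
  · have := le_gaussNorm v (X - C (a i)) zero_le_one 0
    simpa using this
  · have := le_gaussNorm v (X - C (a i)) zero_le_one 1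
    simpa [coeff_C] using this

theorem iSup_coeff_eq_gaussNorm {K : Type*} [Field K] (v : AbsoluteValue K ℝ) {f : K[X]} {n : ℕ}
    (hf : f.natDegree = n) : ⨆ i : Fin (n + 1), v (f.coeff i) = f.gaussNorm v 1 := by
  refine le_antisymm (ciSup_le fun i => ?_) ?_
  · simpa using le_gaussNorm v f zero_le_one i
  · obtain ⟨j, hj⟩ := exists_eq_gaussNorm v 1 f
    rw [hj, one_pow, mul_one]
    rcases lt_or_ge j (n + 1) with h | h
    · exact Finite.le_ciSup_of_le (f := fun i : Fin (n + 1) => v (f.coeff i)) ⟨j, h⟩ le_rfl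
    · rw [coeff_eq_zero_of_natDegree_lt (by omega), map_zero]
      exact Real.iSup_nonneg fun i => v.nonneg _

/-- With the next lemma, this is the only loss in comparing polynomial and roots: each coefficient
is at most a binomial coefficient times the Mahler measure, which in turn is at most the sum of the
n + 1 coefficient sizes. -/
theorem iSup_norm_coeff_le {n : ℕ} {p : ℂ[X]} (hp : p.natDegree = n) :
    ⨆ i : Fin (n + 1), ‖p.coeff i‖ ≤ 2 ^ n * p.mahlerMeasure := by
  refine ciSup_le fun i => (norm_coeff_le_choose_mul_mahlerMeasure i p).trans ?_
  rw [hp]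
  gcongr
  · exact mahlerMeasure_nonneg p
  · exact_mod_cast Nat.choose_le_two_pow n i

theorem mahlerMeasure_le_iSup_norm_coeff {n : ℕ} {p : ℂ[X]} (hp : p.natDegree = n) :
    p.mahlerMeasure ≤ (n + 1) * ⨆ i : Fin (n + 1), ‖p.coeff i‖ := by
  refine (mahlerMeasure_le_sum_norm_coeff p).trans ?_
  rw [sum_over_range' _ (by simp) (n + 1) (by omega), ← Fin.sum_univ_eq_sum_range
    (fun i => ‖p.coeff i‖)]
  refine (Finset.sum_le_card_nsmul _ _ (⨆ i : Fin (n + 1), ‖p.coeff i‖) fun i _ =>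
    Finite.le_ciSup_of_le (f := fun i : Fin (n + 1) => ‖p.coeff i‖) i le_rfl).trans ?_
  simp

/-- The tuple of coefficients of a polynomial of degree at most `n`. -/
def coeffVec {K : Type*} [Field K] (n : ℕ) (f : K[X]) : Fin (n + 1) → K := fun i => f.coeff i

theorem coeffVec_ne_zero {K : Type*} [Field K] {n : ℕ} {f : K[X]} (hf : f.natDegree = n)
    (h0 : f ≠ 0) : coeffVec n f ≠ 0 := by
  refine Function.ne_iff.mpr ⟨Fin.last n, ?_⟩
  simpa [coeffVec, ← hf] using h0

theorem finprod_finitePlace_coeffVec {K ι : Type*} [Field K] [NumberField K] [Fintype ι]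
    (a : ι → K) :
    ∏ᶠ v : FinitePlace K, ⨆ i, v (coeffVec (Fintype.card ι) (∏ j, (X - C (a j))) i) =
      ∏ j, ∏ᶠ v : FinitePlace K, max (v (a j)) 1 := by
  rw [← finprod_prod_comm]
  · refine finprod_congr fun v => ?_
    have := iSup_coeff_eq_gaussNorm v.val (natDegree_prod_X_sub_C' a)
    rw [gaussNorm_prod_X_sub_C (fun x y => FinitePlace.add_le v x y)] at this
    exact this
  · intro j _
    rcases eq_or_ne (a j) 0 with h | h
    · simpa [h] using Function.hasFiniteMulSupport_one
    · refine (FinitePlace.hasFiniteMulSupport h).subset fun v hv => ?_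
      contrapose! hv
      rw [Function.notMem_mulSupport] at hv ⊢
      simp [hv]

theorem prod_infinitePlace_one_le {K : Type*} [Field K] [NumberField K] (c : ℝ) :
    ∏ v : InfinitePlace K, c ^ v.mult = c ^ finrank ℚ K := by
  rw [Finset.prod_pow_eq_pow_sum, InfinitePlace.sum_mult_eq]

theorem infinitePlace_map_prod_X_sub_C {K ι : Type*} [Field K] [Fintype ι]
    (a : ι → K) (v : InfinitePlace K) :
    (∏ j, (X - C (a j))).map v.embedding = ∏ j, (X - C (v.embedding (a j))) := by
  simp [Polynomial.map_prod]

theorem mulHeight_coeffVec_prod {K ι : Type*} [Field K] [NumberField K] [Fintype ι]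
    (a : ι → K) :
    Height.mulHeight (coeffVec (Fintype.card ι) (∏ j, (X - C (a j)))) =
      (∏ v : InfinitePlace K, (⨆ i : Fin (Fintype.card ι + 1),
        ‖(∏ j, (X - C (v.embedding (a j)))).coeff i‖) ^ v.mult) *
      ∏ j, ∏ᶠ v : FinitePlace K, max (v (a j)) 1 := by
  rw [NumberField.mulHeight_eq (coeffVec_ne_zero (natDegree_prod_X_sub_C' a)
    (monic_prod_of_monic _ _ fun i _ => monic_X_sub_C _).ne_zero), finprod_finitePlace_coeffVec]
  congr 1
  refine Finset.prod_congr rfl fun v _ => ?_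
  congr 1
  refine iSup_congr fun i => ?_
  rw [← infinitePlace_map_prod_X_sub_C, coeff_map, InfinitePlace.norm_embedding_eq]
  rfl

/-- The finite factor agrees with the one in `mulHeight_coeffVec_prod`, so only the archimedean
factors have to be compared. -/
theorem prod_mulHeight₁_eq {K ι : Type*} [Field K] [NumberField K] [Fintype ι]
    (a : ι → K) :
    ∏ j, Height.mulHeight₁ (a j) =
      (∏ v : InfinitePlace K, (∏ j, (X - C (v.embedding (a j)))).mahlerMeasure ^ v.mult) *
      ∏ j, ∏ᶠ v : FinitePlace K, max (v (a j)) 1 := by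
  simp_rw [NumberField.mulHeight₁_eq, Finset.prod_mul_distrib, mahlerMeasure_prod_X_sub_C,
    ← Finset.prod_pow]
  rw [Finset.prod_comm]
  simp_rw [InfinitePlace.norm_embedding_eq]

theorem finprod_max_one_nonneg {K ι : Type*} [Field K] [NumberField K] [Fintype ι]
    (a : ι → K) : 0 ≤ ∏ j, ∏ᶠ v : FinitePlace K, max (v (a j)) 1 :=
  Finset.prod_nonneg fun _ _ => finprod_nonneg fun _ => by positivity

/-- The height of a split monic polynomial is bounded by the heights of its roots. -/
theorem mulHeight_coeffVec_le {K ι : Type*} [Field K] [NumberField K] [Fintype ι] (a : ι → K) :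
    Height.mulHeight (coeffVec (Fintype.card ι) (∏ j, (X - C (a j)))) ≤
      (2 ^ Fintype.card ι) ^ finrank ℚ K * ∏ j, Height.mulHeight₁ (a j) := by
  rw [mulHeight_coeffVec_prod, prod_mulHeight₁_eq, ← prod_infinitePlace_one_le, ← mul_assoc,
    ← Finset.prod_mul_distrib]
  refine mul_le_mul_of_nonneg_right ?_ (finprod_max_one_nonneg a)
  refine Finset.prod_le_prod (fun v _ => pow_nonneg (Real.iSup_nonneg fun _ => norm_nonneg _) _)
    fun v _ => ?_
  rw [← mul_pow]
  exact pow_le_pow_left₀ (Real.iSup_nonneg fun _ => norm_nonneg _)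
    (iSup_norm_coeff_le (natDegree_prod_X_sub_C' _)) _

/-- The heights of the roots of a split monic polynomial are bounded by its height. -/
theorem prod_mulHeight₁_le {K ι : Type*} [Field K] [NumberField K] [Fintype ι] (a : ι → K) :
    ∏ j, Height.mulHeight₁ (a j) ≤ ((Fintype.card ι : ℝ) + 1) ^ finrank ℚ K *
      Height.mulHeight (coeffVec (Fintype.card ι) (∏ j, (X - C (a j)))) := by
  rw [mulHeight_coeffVec_prod, prod_mulHeight₁_eq, ← prod_infinitePlace_one_le, ← mul_assoc,
    ← Finset.prod_mul_distrib]
  refine mul_le_mul_of_nonneg_right ?_ (finprod_max_one_nonneg a)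
  refine Finset.prod_le_prod (fun v _ => pow_nonneg (mahlerMeasure_nonneg _) _) fun v _ => ?_
  rw [← mul_pow]
  exact pow_le_pow_left₀ (mahlerMeasure_nonneg _)
    (mahlerMeasure_le_iSup_norm_coeff (natDegree_prod_X_sub_C' _)) _

/-- The minimal polynomial of `α` splits in a number field `L` inside `kbar` as a product over
conjugates, all of which have the height of `α`. -/
theorem exists_splitting {k kbar : Type*} [Field k] [NumberField k] [Field kbar]
    [Algebra k kbar] [IsAlgClosure k kbar] (α : kbar) :
    ∃ (L : IntermediateField k kbar) (_ : NumberField L) (a : Fin (minpoly k α).natDegree → L),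
      (minpoly k α).map (algebraMap k L) = ∏ j, (X - C (a j)) ∧
      ∀ j, Height.mulHeight₁ (a j) = absHeight k ![1, α] ^ finrank ℚ L := by
  classical
  have : Algebra.IsAlgebraic k kbar := IsAlgClosure.isAlgebraic
  have : IsAlgClosed kbar := IsAlgClosure.isAlgClosed k
  have hα : IsIntegral k α := Algebra.IsIntegral.isIntegral α
  set f := minpoly k α with hf
  have hsplit : (f.map (algebraMap k kbar)).Splits := IsAlgClosed.splits _
  have hcard : (f.map (algebraMap k kbar)).roots.card = f.natDegree := by
    rw [← hsplit.natDegree_eq_card_roots, natDegree_map]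
  let b : Fin f.natDegree → kbar := fun j =>
    (f.map (algebraMap k kbar)).roots.toList.get (j.cast (by simp [hcard]))
  have hb : (Finset.univ : Finset (Fin f.natDegree)).val.map b =
      (f.map (algebraMap k kbar)).roots := by
    conv_rhs => rw [← Multiset.coe_toList (f.map (algebraMap k kbar)).roots]
    rw [Fin.univ_def]
    change ((List.map b (List.finRange f.natDegree) : List kbar) : Multiset kbar) = _
    congr 1
    refine List.ext_get (by simp [hcard]) fun n h1 h2 => ?_
    simp [b]
  have hmem : ∀ j, b j ∈ (f.map (algebraMap k kbar)).roots := fun j => by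
    rw [← hb]
    exact Multiset.mem_map_of_mem b (Finset.mem_univ j)
  let L := IntermediateField.adjoin k (Set.range b)
  have hL : NumberField L := numberField_adjoin_range k b
  let a : Fin f.natDegree → L := fun j => ⟨b j, IntermediateField.subset_adjoin k _ ⟨j, rfl⟩⟩
  refine ⟨L, hL, a, ?_, fun j => ?_⟩
  · apply Polynomial.map_injective _ (algebraMap L kbar).injective
    rw [Polynomial.map_map, ← IsScalarTower.algebraMap_eq, Polynomial.map_prod]
    have h1 := hsplit.eq_prod_roots
    rw [((minpoly.monic hα).map (algebraMap k kbar)).leadingCoeff, C_1, one_mul, ← hb,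
      Multiset.map_map] at h1
    rw [h1]
    refine Finset.prod_congr rfl fun j _ => ?_
    simp [a]
  · have h1 := absHeight_one_pow (IntermediateField.val L) (a j)
    rw [← h1]
    congr 1
    refine absHeight_eq_of_minpoly_eq ?_
    refine (minpoly.eq_of_irreducible_of_monic (minpoly.irreducible hα) ?_
      (minpoly.monic hα)).symm
    have := (mem_roots'.mp (hmem j)).2
    rwa [IsRoot.def, eval_map_algebraMap] at this

theorem coeffVec_map {K L : Type*} [Field K] [Field L] [Algebra K L] (n : ℕ) (f : K[X]) :
    coeffVec n (f.map (algebraMap K L)) = fun i => algebraMap K L (coeffVec n f i) := by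
  ext i
  simp [coeffVec]

/-- Comparison of the height of an algebraic number and of its minimal polynomial. -/
theorem mulHeight_minpoly_le_and_le {k kbar : Type*} [Field k] [NumberField k] [Field kbar]
    [Algebra k kbar] [IsAlgClosure k kbar] (α : kbar) {e : ℕ} (he : (minpoly k α).natDegree = e) :
    Height.mulHeight (coeffVec e (minpoly k α)) ≤
      (2 * absHeight k ![1, α]) ^ (e * finrank ℚ k) ∧
    absHeight k ![1, α] ^ (e * finrank ℚ k) ≤
      ((e : ℝ) + 1) ^ finrank ℚ k * Height.mulHeight (coeffVec e (minpoly k α)) := by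
  subst he
  obtain ⟨L, hL, a, hprod, hheight⟩ := exists_splitting (k := k) α
  have : FiniteDimensional k L := Module.Finite.of_restrictScalars_finite ℚ k L
  have hd : finrank ℚ k * finrank k L = finrank ℚ L := finrank_mul_finrank ℚ k L
  have hpos : finrank k L ≠ 0 := finrank_pos.ne'
  have hH := one_le_absHeight (k := k) ![1, α]
  have hc : Fintype.card (Fin (minpoly k α).natDegree) = (minpoly k α).natDegree := Fintype.card_fin _
  have h1 := mulHeight_coeffVec_le a
  have h2 := prod_mulHeight₁_le a
  rw [← hprod, hc, coeffVec_map, mulHeight_algebraMap] at h1 h2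
  -- All roots have the height of α, so both estimates over L become [L : k]-th powers of the
  -- desired ones.
  simp_rw [hheight, Finset.prod_const, Finset.card_univ, hc, ← hd] at h1 h2
  have hm := Height.mulHeight_pos (coeffVec (minpoly k α).natDegree (minpoly k α))
  constructor
  · refine (pow_le_pow_iff_left₀ hm.le (by positivity) hpos).mp (h1.trans_eq ?_)
    ring
  · refine (pow_le_pow_iff_left₀ (by positivity) (by positivity) hpos).mp (Eq.trans_le ?_
      (h2.trans_eq ?_)) <;> ring

end WidmerCount

end


/-! ### A pigeonhole principle at the infinite places. -/

noncomputable section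

namespace WidmerCount

open NumberField Module

theorem abs_sub_lt_of_floor_eq {μ ρ x y : ℝ} (hμ : 0 < μ) (hρ : 0 < ρ)
    (h : ⌊μ * x / ρ⌋ = ⌊μ * y / ρ⌋) : |x - y| < ρ / μ := by
  have h1 := Int.abs_sub_lt_one_of_floor_eq_floor h
  have h2 : μ * x / ρ - μ * y / ρ = (μ / ρ) * (x - y) := by ring
  rw [h2, abs_mul, abs_of_pos (div_pos hμ hρ)] at h1
  rw [lt_div_iff₀ hμ]
  rw [div_mul_eq_mul_div, div_lt_one hρ] at h1
  linarith

theorem floor_mem_Icc {μ ρ x : ℝ} (hμ : 0 < μ) (hρ : 0 < ρ) (hx : |x| ≤ 1) :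
    ⌊μ * x / ρ⌋ ∈ Finset.Icc ⌊-(μ / ρ)⌋ ⌊μ / ρ⌋ := by
  obtain ⟨h1, h2⟩ := abs_le.mp hx
  rw [Finset.mem_Icc]
  constructor <;> apply Int.floor_le_floor
  · rw [← neg_div]
    gcongr
    nlinarith
  · gcongr
    nlinarith

theorem card_Icc_floor_le {r : ℝ} (hr : 0 ≤ r) :
    ((Finset.Icc ⌊-r⌋ ⌊r⌋).card : ℝ) ≤ 2 * r + 2 := by
  have h1 := Int.floor_le r
  have h2 := Int.sub_one_lt_floor (-r)
  have h3 : ⌊-r⌋ ≤ ⌊r⌋ := Int.floor_le_floor (by linarith)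
  rw [Int.card_Icc, ← Int.cast_natCast (R := ℝ), Int.toNat_of_nonneg (by omega)]
  push_cast
  linarith

open Classical in
/-- The scaling factor of the grid at an infinite place. -/
def gridScale {K : Type*} [Field K] (v : InfinitePlace K) : ℝ := if v.IsReal then 1 else 3 / 2

theorem gridScale_pos {K : Type*} [Field K] (v : InfinitePlace K) : 0 < gridScale v := by
  unfold gridScale
  split_ifs <;> norm_num

open Classical in
/-- The possible labels (half and grid cell) at an infinite place. -/
def gridCells {K : Type*} [Field K] (ρ : ℝ) (v : InfinitePlace K) : Finset (Bool × ℤ × ℤ) :=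
  Finset.univ ×ˢ (Finset.Icc ⌊-(gridScale v / ρ)⌋ ⌊gridScale v / ρ⌋ ×ˢ
    if v.IsReal then {0} else Finset.Icc ⌊-(gridScale v / ρ)⌋ ⌊gridScale v / ρ⌋)

theorem card_gridCells_le {K : Type*} [Field K] {ρ : ℝ} (hρ : 0 < ρ) (hρ1 : ρ ≤ 1)
    (v : InfinitePlace K) : ((gridCells ρ v).card : ℝ) ≤ (8 / ρ) ^ v.mult := by
  have h1 : 1 ≤ 1 / ρ := by rwa [le_div_iff₀ hρ, one_mul]
  by_cases hv : v.IsReal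
  -- Two labels times at most 2/ρ + 2 cells: this is at most 8/ρ because ρ ≤ 1.
  · have h := card_Icc_floor_le (r := 1 / ρ) (by positivity)
    simp only [gridCells, gridScale, hv, if_true, Finset.card_product, Finset.card_singleton,
      mul_one, Finset.card_univ, Fintype.card_bool, InfinitePlace.mult, pow_one]
    push_cast
    rw [show 8 / ρ = 8 * (1 / ρ) by ring]
    linarith
  -- Each direction has at most 3/ρ + 2 ≤ 5/ρ cells, and 2 · 25 ≤ 64.
  · have h := card_Icc_floor_le (r := 3 / 2 / ρ) (by positivity)
    rw [show 2 * (3 / 2 / ρ) = 3 * (1 / ρ) by ring] at h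
    simp only [gridCells, gridScale, hv, if_false, Finset.card_product, Finset.card_univ,
      Fintype.card_bool, InfinitePlace.mult]
    push_cast
    rw [show 8 / ρ = 8 * (1 / ρ) by ring]
    have hc := Nat.cast_nonneg (α := ℝ) (Finset.Icc ⌊-(3 / 2 / ρ)⌋ ⌊3 / 2 / ρ⌋).card
    nlinarith

/-- Pigeonhole principle: a set whose images at the infinite places are pairwise far apart
(in the sense of the product of the distances) is small. -/
theorem card_le_of_separated {K ι : Type*} [Field K] [NumberField K] (s : Finset ι)
    (χ : InfinitePlace K → ι → Bool) (φ : InfinitePlace K → ι → ℂ) {ρ : ℝ} (hρ : 0 < ρ)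
    (hρ1 : ρ ≤ 1) (hφ : ∀ v, ∀ t ∈ s, ‖φ v t‖ ≤ 1)
    (hreal : ∀ v : InfinitePlace K, v.IsReal → ∀ t ∈ s, (φ v t).im = 0)
    (hsep : ∀ t ∈ s, ∀ u ∈ s, t ≠ u → (∀ v, χ v t = χ v u) →
      ρ ^ finrank ℚ K ≤ ∏ v : InfinitePlace K, ‖φ v t - φ v u‖ ^ v.mult) :
    (s.card : ℝ) ≤ (8 / ρ) ^ finrank ℚ K := by
  classical
  let code : ι → (v : InfinitePlace K) → Bool × ℤ × ℤ := fun t v =>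
    (χ v t, ⌊gridScale v * (φ v t).re / ρ⌋, ⌊gridScale v * (φ v t).im / ρ⌋)
  have hmaps : ∀ t ∈ s, code t ∈ Fintype.piFinset (gridCells (K := K) ρ) := by
    intro t ht
    rw [Fintype.mem_piFinset]
    intro v
    have h1 : |(φ v t).re| ≤ 1 := (Complex.abs_re_le_norm _).trans (hφ v t ht)
    have h2 : |(φ v t).im| ≤ 1 := (Complex.abs_im_le_norm _).trans (hφ v t ht)
    simp only [gridCells, Finset.mem_product, Finset.mem_univ, true_and, code]
    refine ⟨floor_mem_Icc (gridScale_pos v) hρ h1, ?_⟩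
    split_ifs with hv
    · simp [hreal v hv t ht]
    · exact floor_mem_Icc (gridScale_pos v) hρ h2
  have hinj : Set.InjOn code s := by
    intro t ht u hu htu
    by_contra hne
    have hcode : ∀ v, code t v = code u v := fun v => congrFun htu v
    simp only [code, Prod.mk.injEq] at hcode
    have hlt : ∀ v, ‖φ v t - φ v u‖ < ρ := by
      intro v
      have h1 := abs_sub_lt_of_floor_eq (gridScale_pos v) hρ (hcode v).2.1
      have h2 := abs_sub_lt_of_floor_eq (gridScale_pos v) hρ (hcode v).2.2
      rw [← Complex.sub_re] at h1
      rw [← Complex.sub_im] at h2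
      by_cases hv : v.IsReal
      · have him : (φ v t - φ v u).im = 0 := by simp [hreal v hv t ht, hreal v hv u hu]
        rw [Complex.norm_eq_sqrt_sq_add_sq, him]
        simpa [gridScale, hv, Real.sqrt_sq_eq_abs] using h1
      -- The scale 3/2 gives square cells of side 2ρ/3, whose diagonal is below ρ since 8/9 < 1.
      · simp only [gridScale, hv, if_false] at h1 h2
        rw [Complex.norm_eq_sqrt_sq_add_sq, Real.sqrt_lt' hρ]
        have h3 := sq_lt_sq' (by linarith [abs_nonneg (φ v t - φ v u).re]) h1
        have h4 := sq_lt_sq' (by linarith [abs_nonneg (φ v t - φ v u).im]) h2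
        rw [sq_abs] at h3 h4
        have : (ρ / (3 / 2)) ^ 2 = 4 / 9 * ρ ^ 2 := by ring
        nlinarith [sq_pos_of_pos hρ]
    have hge := hsep t ht u hu hne fun v => (hcode v).1
    refine absurd hge (not_le.mpr ?_)
    rw [← prod_infinitePlace_one_le]
    -- Strict comparison of products needs positive factors; a vanishing factor makes the product
    -- zero and contradicts separation directly.
    by_cases hz : ∃ v, ‖φ v t - φ v u‖ = 0
    · obtain ⟨v, hv⟩ := hz
      rw [Finset.prod_eq_zero (Finset.mem_univ v) (by rw [hv, zero_pow v.mult_ne_zero])]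
      exact Finset.prod_pos fun v _ => pow_pos hρ _
    · push Not at hz
      exact Finset.prod_lt_prod_of_nonempty
        (fun v _ => pow_pos ((norm_nonneg _).lt_of_ne' (hz v)) _)
        (fun v _ => pow_lt_pow_left₀ (hlt v) (norm_nonneg _) v.mult_ne_zero)
        Finset.univ_nonempty
  have hcard := Finset.card_le_card_of_injOn code hmaps hinj
  rw [Fintype.card_piFinset] at hcard
  calc (s.card : ℝ) ≤ ∏ v : InfinitePlace K, ((gridCells ρ v).card : ℝ) := by exact_mod_cast hcard
    _ ≤ ∏ v : InfinitePlace K, (8 / ρ) ^ v.mult :=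
      Finset.prod_le_prod (fun _ _ => Nat.cast_nonneg _) fun v _ => card_gridCells_le hρ hρ1 v
    _ = _ := prod_infinitePlace_one_le _

end WidmerCount

end


/-! ### Separation from the product formula, and the resulting counts. -/

noncomputable section

namespace WidmerCount

open NumberField Module

theorem finitePlace_le_one {K : Type*} [Field K] [NumberField K] (v : FinitePlace K) (x : 𝓞 K) :
    v (x : K) ≤ 1 := by
  rw [← FinitePlace.norm_embedding_eq]
  exact NumberField.FinitePlace.norm_le_one K v.maximalIdeal x

theorem iSup_cons {K : Type*} [Field K] (v : AbsoluteValue K ℝ) {n : ℕ} (t : K)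
    (x : Fin (n + 1) → K) :
    ⨆ i, v ((Fin.cons t x : Fin (n + 2) → K) i) = max (v t) (⨆ i, v (x i)) := by
  refine le_antisymm (ciSup_le fun i => ?_) (max_le ?_ (ciSup_le fun i => ?_))
  · refine Fin.cases ?_ (fun j => ?_) i
    · simp
    · simpa using Or.inr (Finite.le_ciSup_of_le (f := fun i => v (x i)) j le_rfl)
  · exact Finite.le_ciSup_of_le (f := fun i => v ((Fin.cons t x : Fin (n + 2) → K) i)) 0 (by simp)
  · exact Finite.le_ciSup_of_le (f := fun i => v ((Fin.cons t x : Fin (n + 2) → K) i)) i.succ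
      (by simp)

theorem iSup_abv_pos {K ι : Type*} [Field K] [Finite ι] (v : AbsoluteValue K ℝ) {x : ι → K}
    (hx : x ≠ 0) : 0 < ⨆ i, v (x i) := by
  obtain ⟨i, hi⟩ := Function.ne_iff.mp hx
  exact (v.pos hi).trans_le (Finite.le_ciSup_of_le (f := fun i => v (x i)) i le_rfl)

theorem hasFiniteMulSupport_iSup {K ι : Type*} [Field K] [NumberField K] [Finite ι] {x : ι → K}
    (hx : x ≠ 0) : Function.HasFiniteMulSupport fun v : FinitePlace K => ⨆ i, v (x i) := by
  have hfin : (⋃ i : {i // x i ≠ 0},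
      Function.mulSupport fun v : FinitePlace K => v (x i)).Finite :=
    Set.finite_iUnion fun i => FinitePlace.hasFiniteMulSupport i.2
  refine hfin.subset fun v hv => ?_
  contrapose! hv
  simp only [Set.mem_iUnion, Function.mem_mulSupport, not_exists, not_not] at hv
  rw [Function.notMem_mulSupport]
  obtain ⟨i, hi⟩ := Function.ne_iff.mp hx
  have : Nonempty ι := ⟨i⟩
  refine le_antisymm (ciSup_le fun j => ?_) ?_
  · by_cases hj : x j = 0
    · simp [hj]
    · exact (hv ⟨j, hj⟩).le
  · exact Finite.le_ciSup_of_le (f := fun i => v (x i)) i (hv ⟨i, hi⟩).ge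

/-- The projective coordinate of `t` relative to the scale `b` at an infinite place. -/
def chordCoord {K : Type*} [Field K] (v : InfinitePlace K) (b : ℝ) (t : K) : ℂ :=
  if v t ≤ b then v.embedding t / b else b / v.embedding t

theorem norm_chordCoord_le {K : Type*} [Field K] (v : InfinitePlace K) {b : ℝ} (hb : 0 < b)
    (t : K) : ‖chordCoord v b t‖ ≤ 1 := by
  unfold chordCoord
  split_ifs with h
  · rw [norm_div, InfinitePlace.norm_embedding_eq, Complex.norm_real, Real.norm_of_nonneg hb.le]
    exact (div_le_one hb).mpr h
  · rw [norm_div, InfinitePlace.norm_embedding_eq, Complex.norm_real, Real.norm_of_nonneg hb.le]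
    push Not at h
    exact (div_le_one (hb.trans h)).mpr h.le

theorem chordCoord_im {K : Type*} [Field K] {v : InfinitePlace K} (hv : v.IsReal) (b : ℝ)
    (t : K) : (chordCoord v b t).im = 0 := by
  unfold chordCoord
  rw [← InfinitePlace.embedding_of_isReal_apply hv]
  split_ifs
  · rw [← Complex.ofReal_div, Complex.ofReal_im]
  · rw [← Complex.ofReal_div, Complex.ofReal_im]

/-- The coordinates t/b and b/t are the two charts of the Riemann sphere, each on its closed unit
disc. When t and u lie in the same chart, the distance is exactly proportional to |t - u|; the
Boolean label in the pigeonhole principle records the chart. -/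
theorem abv_sub_mul_eq {K : Type*} [Field K] (v : InfinitePlace K) {b : ℝ} (hb : 0 < b)
    {t u : K} (h : v t ≤ b ↔ v u ≤ b) :
    v (t - u) * b = ‖chordCoord v b t - chordCoord v b u‖ * (max (v t) b * max (v u) b) := by
  unfold chordCoord
  have hbn : ‖(b : ℂ)‖ = b := by rw [Complex.norm_real, Real.norm_of_nonneg hb.le]
  by_cases ht : v t ≤ b
  · have hu := h.mp ht
    rw [if_pos ht, if_pos hu, max_eq_right ht, max_eq_right hu, ← sub_div, ← map_sub, norm_div,
      InfinitePlace.norm_embedding_eq, hbn]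
    field_simp
  · have hu : ¬ v u ≤ b := fun hu => ht (h.mpr hu)
    rw [if_neg ht, if_neg hu]
    push Not at ht hu
    rw [max_eq_left ht.le, max_eq_left hu.le]
    have ht0 : v.embedding t ≠ 0 := by
      rw [← norm_pos_iff, InfinitePlace.norm_embedding_eq]; exact hb.trans ht
    have hu0 : v.embedding u ≠ 0 := by
      rw [← norm_pos_iff, InfinitePlace.norm_embedding_eq]; exact hb.trans hu
    rw [div_sub_div _ _ ht0 hu0, ← mul_comm (b : ℂ), ← mul_sub, ← map_sub, norm_div, norm_mul,
      norm_mul]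
    simp only [InfinitePlace.norm_embedding_eq, hbn]
    have := hb.trans ht
    have := hb.trans hu
    rw [InfinitePlace.coe_apply v (u - t), v.val.map_sub u t, ← InfinitePlace.coe_apply]
    field_simp

/-- Two distinct extensions of the tuple `x` by one coordinate cannot be close together. -/
theorem mulHeight_le_prod_dist_mul {K : Type*} [Field K] [NumberField K] {n : ℕ}
    {x : Fin (n + 1) → K} (hx : x ≠ 0) {t u : K} (htu : t ≠ u)
    (h : ∀ v : InfinitePlace K, v t ≤ ⨆ i, v (x i) ↔ v u ≤ ⨆ i, v (x i)) :
    Height.mulHeight x ≤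
      (∏ v : InfinitePlace K, ‖chordCoord v (⨆ i, v (x i)) t - chordCoord v (⨆ i, v (x i)) u‖ ^
        v.mult) * (Height.mulHeight (Fin.cons t x : Fin (n + 2) → K) *
          Height.mulHeight (Fin.cons u x : Fin (n + 2) → K)) := by
  have hcons : ∀ t : K, (Fin.cons t x : Fin (n + 2) → K) ≠ 0 := fun t h0 => hx (by
    ext i
    simpa using congrFun h0 i.succ)
  -- Multiplying H(x) by the product formula for t - u makes the comparison local: an identity at
  -- infinite places, and the ultrametric inequality at finite ones.
  have hprod := prod_abs_eq_one (sub_ne_zero.mpr htu)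
  have hbpos : ∀ v : InfinitePlace K, 0 < ⨆ i, v (x i) := fun v => iSup_abv_pos v.val hx
  have hbpos' : ∀ v : FinitePlace K, 0 < ⨆ i, v (x i) := fun v => iSup_abv_pos v.val hx
  have hs := hasFiniteMulSupport_iSup hx
  have hst := hasFiniteMulSupport_iSup (hcons t)
  have hsu := hasFiniteMulSupport_iSup (hcons u)
  have hsd := FinitePlace.hasFiniteMulSupport (sub_ne_zero.mpr htu)
  rw [← mul_one (Height.mulHeight x), ← hprod, NumberField.mulHeight_eq hx,
    NumberField.mulHeight_eq (hcons t), NumberField.mulHeight_eq (hcons u), mul_mul_mul_comm,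
    mul_mul_mul_comm (∏ v : InfinitePlace K, (⨆ i, v ((Fin.cons t x : Fin (n + 2) → K) i)) ^ _),
    ← mul_assoc (∏ v : InfinitePlace K, _ ^ _) (_ * _) (_ * _), ← finprod_mul_distrib hs hsd, ← finprod_mul_distrib hst hsu]
  refine mul_le_mul (le_of_eq ?_) ?_ ?_ ?_
  · simp_rw [← Finset.prod_mul_distrib, ← mul_pow]
    refine Finset.prod_congr rfl fun v _ => ?_
    rw [mul_comm (⨆ i, v (x i)), abv_sub_mul_eq v (hbpos v) (h v)]
    have h1 := iSup_cons v.val t x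
    have h2 := iSup_cons v.val u x
    simp only [← InfinitePlace.coe_apply] at h1 h2
    rw [h1, h2]
  · refine finprod_le_finprod (hs.mul hsd) (fun v => ?_) (hst.mul hsu) fun v => ?_
    · exact mul_nonneg (hbpos' v).le (v.val.nonneg _)
    · have h1 := iSup_cons v.val t x
      have h2 := iSup_cons v.val u x
      simp only [← FinitePlace.coe_apply] at h1 h2
      simp only [h1, h2]
      have h3 : v (t - u) ≤ max (v t) (v u) := by
        have := FinitePlace.add_le v t (-u)
        rwa [← sub_eq_add_neg, FinitePlace.coe_apply v (-u), v.val.map_neg] at this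
      have hb := hbpos' v
      rcases le_max_iff.mp h3 with h4 | h4
      · rw [mul_comm]
        exact mul_le_mul (h4.trans (le_max_left _ _)) (le_max_right _ _) hb.le
          (hb.le.trans (le_max_right _ _))
      · exact mul_le_mul (le_max_right _ _) (h4.trans (le_max_left _ _)) (v.val.nonneg _)
          (hb.le.trans (le_max_right _ _))
  · exact finprod_nonneg fun v => mul_nonneg (hbpos' v).le (v.val.nonneg _)
  · refine mul_nonneg (Finset.prod_nonneg fun v _ => pow_nonneg (norm_nonneg _) _) (mul_nonneg ?_ ?_)
    · exact Finset.prod_nonneg fun v _ => pow_nonneg (iSup_abv_pos v.val (hcons t)).le _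
    · exact Finset.prod_nonneg fun v _ => pow_nonneg (iSup_abv_pos v.val (hcons u)).le _

theorem mulHeight_le_mulHeight_cons {K : Type*} [Field K] [NumberField K] {n : ℕ}
    (x : Fin (n + 1) → K) (t : K) :
    Height.mulHeight x ≤ Height.mulHeight (Fin.cons t x : Fin (n + 2) → K) := by
  have := Height.mulHeight_comp_le (K := K) (Fin.succ : Fin (n + 1) → Fin (n + 2)) (Fin.cons t x)
  exact this

/-- A separated set is small, with the separation given by an arbitrary real `q ≤ 1`. -/
theorem card_mul_le_of_separated {K ι : Type*} [Field K] [NumberField K] (s : Finset ι)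
    (χ : InfinitePlace K → ι → Bool) (φ : InfinitePlace K → ι → ℂ) {q : ℝ} (hq : 0 < q)
    (hq1 : q ≤ 1) (hφ : ∀ v, ∀ t ∈ s, ‖φ v t‖ ≤ 1)
    (hreal : ∀ v : InfinitePlace K, v.IsReal → ∀ t ∈ s, (φ v t).im = 0)
    (hsep : ∀ t ∈ s, ∀ u ∈ s, t ≠ u → (∀ v, χ v t = χ v u) →
      q ≤ ∏ v : InfinitePlace K, ‖φ v t - φ v u‖ ^ v.mult) :
    (s.card : ℝ) * q ≤ 8 ^ finrank ℚ K := by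
  have hm : finrank ℚ K ≠ 0 := finrank_pos.ne'
  -- The mesh ρ is the root of q of order [K : ℚ].
  have hρ : (q ^ ((finrank ℚ K : ℝ)⁻¹)) ^ finrank ℚ K = q := Real.rpow_inv_natCast_pow hq.le hm
  have h := card_le_of_separated s χ φ (ρ := q ^ ((finrank ℚ K : ℝ)⁻¹))
    (Real.rpow_pos_of_pos hq _) (Real.rpow_le_one hq.le hq1 (by positivity)) hφ hreal
    (by rwa [hρ])
  rw [div_pow, hρ, le_div_iff₀ hq] at h
  exact h

/-- The number of extensions of a nonzero tuple by one coordinate to a tuple of height at most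
`W`. -/
theorem card_extensions_le {K : Type*} [Field K] [NumberField K] {n : ℕ}
    {x : Fin (n + 1) → K} (hx : x ≠ 0) {W : ℝ} (s : Finset K)
    (hs : ∀ t ∈ s, Height.mulHeight (Fin.cons t x : Fin (n + 2) → K) ≤ W) :
    (s.card : ℝ) ≤ 8 ^ finrank ℚ K * W ^ 2 * (Height.mulHeight x)⁻¹ := by
  rcases s.eq_empty_or_nonempty with rfl | ⟨t₀, ht₀⟩
  · have := Height.mulHeight_pos x
    simpa using by positivity
  have hpos := Height.mulHeight_pos x
  have hone := Height.one_le_mulHeight x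
  have hW : Height.mulHeight x ≤ W := (mulHeight_le_mulHeight_cons x t₀).trans (hs t₀ ht₀)
  have hW0 : 0 < W := hpos.trans_le hW
  have h := card_mul_le_of_separated s (fun v t => decide (v t ≤ ⨆ i, v (x i)))
    (fun v t => chordCoord v (⨆ i, v (x i)) t) (q := Height.mulHeight x / W ^ 2) (by positivity)
    (by rw [div_le_one (by positivity)]; nlinarith)
    (fun v t _ => norm_chordCoord_le v (iSup_abv_pos v.val hx) t)
    (fun v hv t _ => chordCoord_im hv _ t)
    (fun t ht u hu htu hcol => by
      have h1 := mulHeight_le_prod_dist_mul hx htu fun v => by simpa using hcol v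
      rw [div_le_iff₀ (by positivity), sq]
      refine h1.trans (mul_le_mul_of_nonneg_left ?_
        (Finset.prod_nonneg fun v _ => pow_nonneg (norm_nonneg _) _))
      exact mul_le_mul (hs t ht) (hs u hu) (Height.mulHeight_pos _).le hW0.le)
  rw [← mul_div_assoc, div_le_iff₀ (by positivity)] at h
  rwa [← div_eq_mul_inv, le_div_iff₀ hpos]

/-- If `w` and `c * w` are nonzero algebraic integers, then the height of `c` is bounded in terms
of the sizes of `w` and `c * w`. -/
theorem mulHeight₁_le_of_integral {K : Type*} [Field K] [NumberField K] {c : K} {w z : 𝓞 K}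
    (hw : w ≠ 0) (hz : c * w = z) :
    Height.mulHeight₁ c ≤ ∏ v : InfinitePlace K, (v (w : K) * max (v c) 1) ^ v.mult := by
  have hw' : (w : K) ≠ 0 := by simpa using hw
  have hprod := prod_abs_eq_one hw'
  have hsc : Function.HasFiniteMulSupport fun v : FinitePlace K => max (v c) 1 := by
    rcases eq_or_ne c 0 with rfl | hc
    · simpa using Function.hasFiniteMulSupport_one
    · refine (FinitePlace.hasFiniteMulSupport hc).subset fun v hv => ?_
      contrapose! hv
      rw [Function.notMem_mulSupport] at hv ⊢
      simp [hv]
  have hsw := FinitePlace.hasFiniteMulSupport hw'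
  have hsplit : Height.mulHeight₁ c =
      (∏ v : InfinitePlace K, (v (w : K) * max (v c) 1) ^ v.mult) *
        ∏ᶠ v : FinitePlace K, v (w : K) * max (v c) 1 := by
    refine (mul_one (Height.mulHeight₁ c)).symm.trans ((congrArg _ hprod.symm).trans ?_)
    rw [NumberField.mulHeight₁_eq, mul_mul_mul_comm, ← Finset.prod_mul_distrib, ← finprod_mul_distrib hsc hsw]
    simp_rw [← mul_pow, mul_comm (max _ _)]
  rw [hsplit]
  -- At a finite place the factor is max(|cw|, |w|), which is at most 1 since both are integral.
  have hfin : ∏ᶠ v : FinitePlace K, v (w : K) * max (v c) 1 ≤ 1 := by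
    refine le_of_le_of_eq (finprod_le_finprod (hsw.mul hsc)
      (fun v => mul_nonneg (v.val.nonneg _) (by positivity)) Function.hasFiniteMulSupport_one
      fun v => ?_) finprod_one
    change v (w : K) * max (v c) 1 ≤ 1
    rw [mul_max_of_nonneg _ _ (show 0 ≤ v (w : K) from v.val.nonneg _), mul_one, mul_comm, ← map_mul, hz]
    exact max_le (finitePlace_le_one v z) (finitePlace_le_one v w)
  refine mul_le_of_le_one_right (Finset.prod_nonneg fun v _ => ?_) hfin
  exact pow_nonneg (mul_nonneg (v.val.nonneg _) (by positivity)) _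

theorem abv_mul_max_le {K : Type*} [Field K] (v : InfinitePlace K) {c w : K} {R : ℝ}
    (hw : v w ≤ R) (hc : v (c * w) ≤ R) : v w * max (v c) 1 ≤ R := by
  rw [mul_max_of_nonneg _ _ (show 0 ≤ v w from v.val.nonneg _), mul_one, mul_comm, ← map_mul]
  exact max_le hc hw

theorem mulHeight₁_le_pow_of_integral {K : Type*} [Field K] [NumberField K] {c : K} {w z : 𝓞 K}
    (hw : w ≠ 0) (hz : c * w = z) {R : ℝ} (hwR : ∀ v : InfinitePlace K, v (w : K) ≤ R)
    (hzR : ∀ v : InfinitePlace K, v (z : K) ≤ R) :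
    Height.mulHeight₁ c ≤ R ^ finrank ℚ K := by
  refine (mulHeight₁_le_of_integral hw hz).trans ?_
  rw [← prod_infinitePlace_one_le]
  refine Finset.prod_le_prod (fun v _ => pow_nonneg (mul_nonneg (v.val.nonneg _)
    (by positivity)) _) fun v _ => ?_
  exact pow_le_pow_left₀ (mul_nonneg (v.val.nonneg _) (by positivity))
    (abv_mul_max_le v (hwR v) (by rw [hz]; exact hzR v)) _

/-- The number of algebraic integers `t` of size at most `R` such that also `c * t` is an
algebraic integer of size at most `R`. -/
theorem card_common_multiples_le {K : Type*} [Field K] [NumberField K] {c : K} {R : ℝ}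
    (hR : 0 < R) (hc : Height.mulHeight₁ c ≤ R ^ finrank ℚ K) (s : Finset (𝓞 K))
    (hs : ∀ t ∈ s, (∃ z : 𝓞 K, c * t = z) ∧ (∀ v : InfinitePlace K, v (t : K) ≤ R) ∧
      ∀ v : InfinitePlace K, v (c * t) ≤ R) :
    (s.card : ℝ) ≤ 8 ^ finrank ℚ K * R ^ finrank ℚ K * (Height.mulHeight₁ c)⁻¹ := by
  have hpos := Height.mulHeight₁_pos c
  have hmax : ∀ v : InfinitePlace K, 0 < max (v c) 1 := fun v => by positivity
  have hnorm : ∀ (v : InfinitePlace K) (t : K),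
      ‖v.embedding t * ((max (v c) 1 / R : ℝ) : ℂ)‖ = v t * max (v c) 1 / R := fun v t => by
    rw [norm_mul, InfinitePlace.norm_embedding_eq, Complex.norm_real,
      Real.norm_of_nonneg (by have := hmax v; positivity), mul_div_assoc]
  -- Scaling by max(|c|, 1)/R puts every t in the unit disc, so one chart suffices. For distinct t
  -- and u, both t - u and c(t - u) are integral, and `mulHeight₁_le_of_integral` gives the
  -- separation.
  have h := card_mul_le_of_separated s (fun _ _ => true)
    (fun v (t : 𝓞 K) => v.embedding (t : K) * ((max (v c) 1 / R : ℝ) : ℂ))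
    (q := Height.mulHeight₁ c / R ^ finrank ℚ K) (by positivity)
    ((div_le_one (by positivity)).mpr hc)
    (fun v t ht => by
      rw [hnorm, div_le_one hR]
      exact abv_mul_max_le v ((hs t ht).2.1 v) ((hs t ht).2.2 v))
    (fun v hv t _ => by
      rw [← InfinitePlace.embedding_of_isReal_apply hv, ← Complex.ofReal_mul, Complex.ofReal_im])
    (fun t ht u hu htu _ => by
      obtain ⟨z, hz⟩ := (hs t ht).1
      obtain ⟨y, hy⟩ := (hs u hu).1
      have h1 := mulHeight₁_le_of_integral (c := c) (w := t - u) (z := z - y)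
        (sub_ne_zero.mpr htu) (by push_cast; rw [mul_sub, hz, hy])
      rw [div_le_iff₀ (by positivity), ← prod_infinitePlace_one_le, ← Finset.prod_mul_distrib]
      refine h1.trans_eq (Finset.prod_congr rfl fun v _ => ?_)
      rw [← mul_pow, ← sub_mul, ← map_sub, hnorm, div_mul_cancel₀ _ hR.ne']
      push_cast
      rfl)
  rw [← mul_div_assoc, div_le_iff₀ (by positivity)] at h
  rwa [← div_eq_mul_inv, le_div_iff₀ hpos]

end WidmerCount

end


/-! ### Dyadic summation and the count of affine points. -/

noncomputable section

namespace WidmerCount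

open NumberField Module

theorem sum_indicator_le {ι : Type*} (s : Finset ι) (h : ι → ℝ) (Y : ℕ → ℝ) (g : ℕ → ℝ) (M : ℕ)
    (f : ι → ℝ) (hg : ∀ j, 0 ≤ g j)
    (hf : ∀ i ∈ s, ∃ j < M, h i ≤ Y j ∧ f i ≤ g j) :
    ∑ i ∈ s, f i ≤ ∑ j ∈ Finset.range M, ((s.filter fun i => h i ≤ Y j).card : ℝ) * g j := by
  classical
  calc ∑ i ∈ s, f i ≤ ∑ i ∈ s, ∑ j ∈ Finset.range M, if h i ≤ Y j then g j else 0 := by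
        refine Finset.sum_le_sum fun i hi => ?_
        obtain ⟨j, hj, h1, h2⟩ := hf i hi
        refine h2.trans ?_
        have := Finset.single_le_sum (f := fun j => if h i ≤ Y j then g j else 0)
          (fun j _ => by split_ifs; exacts [hg j, le_rfl]) (Finset.mem_range.mpr hj)
        simpa [h1] using this
    _ = _ := by
        rw [Finset.sum_comm]
        refine Finset.sum_congr rfl fun j _ => ?_
        rw [← Finset.sum_filter, Finset.sum_const, nsmul_eq_mul]

theorem sum_half_pow_le (M : ℕ) : ∑ j ∈ Finset.range M, (1 / 2 : ℝ) ^ j ≤ 2 := by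
  have h := (summable_geometric_two).sum_le_tsum (Finset.range M) fun i _ => by positivity
  rwa [tsum_geometric_two] at h

/-- Dyadic summation of `1 / h` for a counting function of order at least two. -/
theorem sum_inv_le {ι : Type*} (s : Finset ι) (h : ι → ℝ) {A W : ℝ} (a : ℕ) (hA : 0 ≤ A) (hW0 : 0 ≤ W)
    (h1 : ∀ i ∈ s, 1 ≤ h i) (hW : ∀ i ∈ s, h i ≤ W)
    (hcount : ∀ Y : ℝ, 0 < Y → ((s.filter fun i => h i ≤ Y).card : ℝ) ≤ A * Y ^ (a + 2)) :
    ∑ i ∈ s, (h i)⁻¹ ≤ 4 * A * W ^ (a + 1) := by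
  rcases s.eq_empty_or_nonempty with rfl | ⟨i₀, hi₀⟩
  · simpa using by positivity
  have hW1 : 1 ≤ W := (h1 i₀ hi₀).trans (hW i₀ hi₀)
  obtain ⟨M, hM⟩ := pow_unbounded_of_one_lt W (one_lt_two (α := ℝ))
  -- Levels descend from W: on W/2^(j+1) < h ≤ W/2^j the term 1/h is at most 2^(j+1)/W.
  have key := sum_indicator_le s h (fun j => W / 2 ^ j) (fun j => 2 ^ (j + 1) / W) (M + 1)
    (fun i => (h i)⁻¹) (fun j => by positivity) (fun i hi => by
      have hi1 := h1 i hi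
      have hiW := hW i hi
      have hpos : 0 < h i := by linarith
      obtain ⟨j, hj1, hj2⟩ := exists_nat_pow_near (x := W / h i) (y := 2)
        ((one_le_div hpos).mpr hiW) one_lt_two
      refine ⟨j, ?_, ?_, ?_⟩
      · have : (2 : ℝ) ^ j < 2 ^ M := hj1.trans_lt ((div_le_self (by linarith) hi1).trans_lt hM)
        have := (pow_lt_pow_iff_right₀ (one_lt_two (α := ℝ))).mp this
        omega
      · rw [le_div_iff₀ hpos] at hj1
        rw [le_div_iff₀ (by positivity)]
        linarith
      · rw [inv_le_comm₀ hpos (by positivity), inv_div, div_le_iff₀ (by positivity)]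
        rw [div_lt_iff₀ hpos] at hj2
        linarith)
  refine key.trans ?_
  calc _ ≤ ∑ j ∈ Finset.range (M + 1), 2 * A * W ^ (a + 1) * (1 / 2 : ℝ) ^ j := by
        refine Finset.sum_le_sum fun j _ => ?_
        refine (mul_le_mul_of_nonneg_right (hcount (W / 2 ^ j) (by positivity))
          (by positivity)).trans ?_
        have e : A * (W / 2 ^ j) ^ (a + 2) * (2 ^ (j + 1) / W) =
            2 * A * W ^ (a + 1) * ((1 / 2 : ℝ) ^ j) ^ (a + 1) := by
          rw [div_pow, one_div, inv_pow, inv_pow]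
          field_simp
          ring
        rw [e]
        -- Counting order a + 2 leaves the decay 2^(-j(a+1)), which is at least as fast as 2^(-j).
        refine mul_le_mul_of_nonneg_left ?_ (by positivity)
        exact pow_le_of_le_one (by positivity) (pow_le_one₀ (by norm_num) (by norm_num))
          (by omega)
    _ ≤ 2 * A * W ^ (a + 1) * 2 := by
        rw [← Finset.mul_sum]
        exact mul_le_mul_of_nonneg_left (sum_half_pow_le _) (by positivity)
    _ = _ := by ring

/-- Dyadic summation of `1 / h ^ 3` for a counting function of order two. -/
theorem sum_inv_cube_le {ι : Type*} (s : Finset ι) (h : ι → ℝ) {A W : ℝ} (hA : 0 ≤ A)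
    (h1 : ∀ i ∈ s, 1 ≤ h i) (hW : ∀ i ∈ s, h i ≤ W)
    (hcount : ∀ Y : ℝ, 0 < Y → ((s.filter fun i => h i ≤ Y).card : ℝ) ≤ A * Y ^ 2) :
    ∑ i ∈ s, (h i)⁻¹ ^ 3 ≤ 8 * A := by
  obtain ⟨M, hM⟩ := pow_unbounded_of_one_lt W (one_lt_two (α := ℝ))
  -- Levels ascend from 1: a count of order 4^j against terms 8^(-j) converges, so the bound does
  -- not depend on W.
  have key := sum_indicator_le s h (fun j => 2 ^ (j + 1)) (fun j => ((1 / 2 : ℝ) ^ j) ^ 3) M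
    (fun i => (h i)⁻¹ ^ 3) (fun j => by positivity) (fun i hi => by
      have hi1 := h1 i hi
      have hpos : 0 < h i := by linarith
      obtain ⟨j, hj1, hj2⟩ := exists_nat_pow_near (x := h i) (y := 2) hi1 one_lt_two
      refine ⟨j, ?_, hj2.le, ?_⟩
      · exact (pow_lt_pow_iff_right₀ (one_lt_two (α := ℝ))).mp
          (hj1.trans_lt ((hW i hi).trans_lt hM))
      · refine pow_le_pow_left₀ (by positivity) ?_ 3
        rw [one_div, inv_pow]
        exact inv_anti₀ (by positivity) hj1)
  refine key.trans ?_
  calc _ ≤ ∑ j ∈ Finset.range M, 4 * A * (1 / 2 : ℝ) ^ j := by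
        refine Finset.sum_le_sum fun j _ => ?_
        refine (mul_le_mul_of_nonneg_right (hcount (2 ^ (j + 1)) (by positivity))
          (by positivity)).trans_eq ?_
        rw [one_div, inv_pow]
        field_simp
        ring
    _ ≤ 4 * A * 2 := by
        rw [← Finset.mul_sum]
        exact mul_le_mul_of_nonneg_left (sum_half_pow_le _) (by positivity)
    _ = _ := by ring

/-- Uniform bound for the number of affine points of bounded height over a number field. -/
theorem card_affine_le {K : Type*} [Field K] [NumberField K] (n : ℕ) :
    ∀ (W : ℝ) (s : Finset (Fin (n + 2) → K)),
      (∀ x ∈ s, x (Fin.last _) = 1 ∧ Height.mulHeight x ≤ W) →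
      (s.card : ℝ) ≤ 4 ^ n * 8 ^ (finrank ℚ K * (n + 1)) * |W| ^ (n + 2) := by
  classical
  induction n with
  | zero =>
    intro W s hs
    have hone : (fun _ : Fin 1 => (1 : K)) ≠ 0 := fun h => one_ne_zero (congrFun h 0)
    have hx : ∀ x ∈ s, x = Fin.cons (x 0) (fun _ : Fin 1 => (1 : K)) := fun x hx => by
      ext i
      fin_cases i
      · rfl
      · exact (hs x hx).1
    have h := card_extensions_le hone (W := W) (s.image fun x => x 0) (fun t ht => by
      obtain ⟨x, hxs, rfl⟩ := Finset.mem_image.mp ht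
      exact (hx x hxs) ▸ (hs x hxs).2)
    rw [Finset.card_image_of_injOn (fun x hxs y hys hxy => by
      rw [hx x hxs, hx y hys]
      exact congrArg (fun t => (Fin.cons t (fun _ => 1) : Fin 2 → K)) hxy)] at h
    have h1 : Height.mulHeight (fun _ : Fin 1 => (1 : K)) = 1 := Height.mulHeight_one
    rw [h1] at h
    simpa using h
  | succ n ih =>
    intro W s hs
    -- Dropping the first coordinate keeps the final 1 and does not raise the height; the fibres are
    -- counted by `card_extensions_le`.
    set T := s.image fun x => (Fin.tail x : Fin (n + 2) → K) with hT
    have hTs : ∀ y ∈ T, y (Fin.last _) = 1 ∧ Height.mulHeight y ≤ W := by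
      intro y hy
      obtain ⟨x, hx, rfl⟩ := Finset.mem_image.mp hy
      refine ⟨(hs x hx).1, ?_⟩
      have := mulHeight_le_mulHeight_cons (Fin.tail x) (x 0)
      rw [Fin.cons_self_tail] at this
      exact this.trans (hs x hx).2
    rcases s.eq_empty_or_nonempty with rfl | ⟨x₀, hx₀⟩
    · simpa using by positivity
    have hW : 0 < W := (Height.mulHeight_pos _).trans_le (hs x₀ hx₀).2
    have hfib : ∀ y ∈ T, ((s.filter fun x => (Fin.tail x : Fin (n + 2) → K) = y).card : ℝ) ≤
        8 ^ finrank ℚ K * W ^ 2 * (Height.mulHeight y)⁻¹ := by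
      intro y hy
      have hy0 : y ≠ 0 := fun h => by simpa [h] using (hTs y hy).1
      have hx : ∀ x ∈ s.filter fun x => (Fin.tail x : Fin (n + 2) → K) = y,
          x = Fin.cons (x 0) y := fun x hx => by
        rw [← (Finset.mem_filter.mp hx).2, Fin.cons_self_tail]
      have h := card_extensions_le hy0 (W := W)
        ((s.filter fun x => (Fin.tail x : Fin (n + 2) → K) = y).image fun x => x 0) (fun t ht => by
          obtain ⟨x, hxs, rfl⟩ := Finset.mem_image.mp ht
          have h1 := (hs x (Finset.mem_filter.mp hxs).1).2
          rw [hx x hxs] at h1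
          exact h1)
      rwa [Finset.card_image_of_injOn (fun x hxs z hzs hxz => by
        rw [hx x hxs, hx z hzs]
        exact congrArg (fun t => (Fin.cons t y : Fin (n + 3) → K)) hxz)] at h
    have hsum := sum_inv_le T (fun y => Height.mulHeight y) (W := W)
      (A := 4 ^ n * 8 ^ (finrank ℚ K * (n + 1))) n (by positivity) hW.le
      (fun y _ => Height.one_le_mulHeight y) (fun y hy => (hTs y hy).2) (fun Y hY => by
        have := ih Y (T.filter fun y => Height.mulHeight y ≤ Y) fun y hy =>
          ⟨(hTs y (Finset.mem_filter.mp hy).1).1, (Finset.mem_filter.mp hy).2⟩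
        rwa [abs_of_pos hY] at this)
    rw [Finset.card_eq_sum_card_image (fun x => (Fin.tail x : Fin (n + 2) → K)) s, ← hT,
      abs_of_pos hW]
    push_cast
    calc _ ≤ ∑ y ∈ T, 8 ^ finrank ℚ K * W ^ 2 * (Height.mulHeight y)⁻¹ := Finset.sum_le_sum hfib
      _ = 8 ^ finrank ℚ K * W ^ 2 * ∑ y ∈ T, (Height.mulHeight y)⁻¹ := by rw [Finset.mul_sum]
      _ ≤ 8 ^ finrank ℚ K * W ^ 2 * (4 * (4 ^ n * 8 ^ (finrank ℚ K * (n + 1))) * W ^ (n + 1)) :=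
        mul_le_mul_of_nonneg_left hsum (by positivity)
      _ = _ := by ring

/-- Uniform bound for the number of elements of bounded height of a number field. -/
theorem card_mulHeight₁_le {K : Type*} [Field K] [NumberField K] {W : ℝ} (hW : 0 ≤ W)
    (s : Finset K) (hs : ∀ t ∈ s, Height.mulHeight₁ t ≤ W) :
    (s.card : ℝ) ≤ 8 ^ finrank ℚ K * W ^ 2 := by
  classical
  have h := card_affine_le (K := K) 0 W (s.image fun t => ![t, 1]) (fun x hx => by
    obtain ⟨t, ht, rfl⟩ := Finset.mem_image.mp hx
    refine ⟨rfl, ?_⟩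
    rw [← Height.mulHeight₁_eq_mulHeight]
    exact hs t ht)
  rw [Finset.card_image_of_injective _ (fun a b hab => congrFun hab 0), abs_of_nonneg hW] at h
  simpa using h

end WidmerCount

end


/-! ### Numbers of degree e, the upper bound for Z, and both bounds for N_δ. -/

noncomputable section

namespace WidmerCount

open NumberField Module Polynomial IntermediateField

/-- The algebraic numbers of degree `e` over `k` and height at most `X`. -/
def numbersOfDegree (k kbar : Type*) [Field k] [NumberField k] [Field kbar]
    [Algebra k kbar] [IsAlgClosure k kbar] (e : ℕ) (X : ℝ) : Set kbar :=
  {α | finrank k k⟮α⟯ = e ∧ absHeight k ![1, α] ≤ X}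

theorem isIntegral_of_isAlgClosure (k : Type*) {kbar : Type*} [Field k] [Field kbar]
    [Algebra k kbar] [IsAlgClosure k kbar] (α : kbar) : IsIntegral k α := by
  have : Algebra.IsAlgebraic k kbar := IsAlgClosure.isAlgebraic
  exact Algebra.IsIntegral.isIntegral α

theorem finrank_adjoin_eq_natDegree (k : Type*) {kbar : Type*} [Field k] [Field kbar]
    [Algebra k kbar] [IsAlgClosure k kbar] (α : kbar) :
    finrank k k⟮α⟯ = (minpoly k α).natDegree :=
  adjoin.finrank (isIntegral_of_isAlgClosure k α)

/-- The point `(1 : α)` of the projective line. -/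
def affinePoint {kbar : Type*} [Field kbar] (α : kbar) : ProjSpace kbar 1 :=
  Projectivization.mk kbar ![1, α] fun h => one_ne_zero (congrFun h 0)

theorem affinePoint_injective {kbar : Type*} [Field kbar] :
    Function.Injective (affinePoint : kbar → ProjSpace kbar 1) := by
  intro α β h
  obtain ⟨a, ha⟩ := (Projectivization.mk_eq_mk_iff' _ _ _ _ _).mp h
  have h0 := congrFun ha 0
  have h1 := congrFun ha 1
  simp only [Pi.smul_apply, smul_eq_mul, Matrix.cons_val_zero, Matrix.cons_val_one, mul_one]
    at h0 h1
  rw [← h1, h0, one_mul]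

theorem rep_affinePoint {kbar : Type*} [Field kbar] (α : kbar) :
    ∃ a : kbar, a ≠ 0 ∧ (affinePoint α).rep = a • ![1, α] := by
  obtain ⟨a, ha⟩ := Projectivization.exists_smul_eq_mk_rep kbar ![1, α]
    fun h => one_ne_zero (congrFun h 0)
  exact ⟨a, a.ne_zero, ha.symm⟩

theorem fieldOfPoint_affinePoint {k kbar : Type*} [Field k] [Field kbar] [Algebra k kbar]
    (α : kbar) : fieldOfPoint k (affinePoint α) = k⟮α⟯ := by
  obtain ⟨a, ha, h⟩ := rep_affinePoint α
  rw [fieldOfPoint, h]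
  have hα : α ∈ k⟮α⟯ := mem_adjoin_simple_self k α
  apply le_antisymm
  · rw [adjoin_le_iff]
    rintro x ⟨i, j, hj, rfl⟩
    fin_cases i <;> fin_cases j
    · simp [ha]
    · simpa [ha, div_mul_cancel_left₀] using inv_mem hα
    · simpa [ha] using hα
    · by_cases h0 : α = 0 <;> simp [ha, h0]
  · rw [adjoin_simple_le_iff]
    exact subset_adjoin k _ ⟨1, 0, by simpa using ha, by simp [ha]⟩

/-- The only non-affine point is (0 : 1), which is rational over k. -/
theorem exists_affinePoint_eq {k kbar : Type*} [Field k] [Field kbar] [Algebra k kbar]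
    (P : ProjSpace kbar 1) (hP : finrank k (fieldOfPoint k P) ≠ 1) :
    ∃ α, affinePoint α = P := by
  by_cases h0 : P.rep 0 = 0
  · exfalso
    apply hP
    rw [IntermediateField.finrank_eq_one_iff, fieldOfPoint, adjoin_eq_bot_iff]
    rintro x ⟨i, j, hj, rfl⟩
    fin_cases j
    · exact absurd h0 hj
    · fin_cases i
      · simp [h0]
      · have : P.rep 1 ≠ 0 := hj
        simp [this]
  · refine ⟨P.rep 1 / P.rep 0, ?_⟩
    conv_rhs => rw [← P.mk_rep]
    rw [affinePoint, Projectivization.mk_eq_mk_iff']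
    refine ⟨(P.rep 0)⁻¹, ?_⟩
    ext i
    fin_cases i
    · simp [h0]
    · simp [div_eq_inv_mul]

theorem finite_and_ncard_le_of_forall_finset {α : Type*} {S : Set α} {B : ℝ}
    (h : ∀ s : Finset α, (s : Set α) ⊆ S → (s.card : ℝ) ≤ B) : S.Finite ∧ (S.ncard : ℝ) ≤ B := by
  have hfin : S.Finite := by
    by_contra hinf
    obtain ⟨s, hs, hcard⟩ := Set.Infinite.exists_subset_card_eq hinf (⌊B⌋₊ + 1)
    have h1 := h s hs
    rw [hcard] at h1
    have h2 := Nat.lt_floor_add_one B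
    push_cast at h1
    linarith
  refine ⟨hfin, ?_⟩
  rw [Set.ncard_eq_toFinset_card S hfin]
  exact h _ (by simp)

section

variable {k kbar : Type*} [Field k] [NumberField k] [Field kbar] [Algebra k kbar]
  [IsAlgClosure k kbar]

theorem projHeight_affinePoint (α : kbar) : projHeight k (affinePoint α) = absHeight k ![1, α] := by
  obtain ⟨a, ha, h⟩ := rep_affinePoint α
  rw [projHeight, h, absHeight_smul _ ha]

theorem pointsOfDegree_eq_image {e : ℕ} (he : e ≠ 1) (X : ℝ) :
    pointsOfDegree k kbar 1 e X = affinePoint '' numbersOfDegree k kbar e X := by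
  ext P
  constructor
  · rintro ⟨h1, h2⟩
    obtain ⟨α, rfl⟩ := exists_affinePoint_eq P (h1 ▸ he)
    rw [fieldOfPoint_affinePoint] at h1
    rw [projHeight_affinePoint] at h2
    exact ⟨α, ⟨h1, h2⟩, rfl⟩
  · rintro ⟨α, ⟨h1, h2⟩, rfl⟩
    refine ⟨?_, ?_⟩
    · rw [fieldOfPoint_affinePoint, h1]
    · rwa [projHeight_affinePoint]

theorem finite_pointsOfDegree_iff {e : ℕ} (he : e ≠ 1) (X : ℝ) :
    (pointsOfDegree k kbar 1 e X).Finite ↔ (numbersOfDegree k kbar e X).Finite := by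
  rw [pointsOfDegree_eq_image he, Set.finite_image_iff affinePoint_injective.injOn]

theorem ncard_pointsOfDegree {e : ℕ} (he : e ≠ 1) (X : ℝ) :
    (pointsOfDegree k kbar 1 e X).ncard = (numbersOfDegree k kbar e X).ncard := by
  rw [pointsOfDegree_eq_image he, Set.ncard_image_of_injective _ affinePoint_injective]

/-- The factor n + 1 bounds the number of roots sharing a minimal polynomial; the rest counts
coefficient vectors, normalised by their leading entry 1. -/
theorem card_numbersOfDegree_le {n : ℕ} {X : ℝ} (hX : 0 ≤ X) (s : Finset kbar)
    (hs : (s : Set kbar) ⊆ numbersOfDegree k kbar (n + 1) X) :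
    (s.card : ℝ) ≤ (n + 1) * (4 ^ n * 8 ^ (finrank ℚ k * (n + 1)) *
      ((2 * X) ^ ((n + 1) * finrank ℚ k)) ^ (n + 2)) := by
  classical
  have hdeg : ∀ α ∈ s, (minpoly k α).natDegree = n + 1 := fun α hα => by
    rw [← finrank_adjoin_eq_natDegree, (hs hα).1]
  have hfib : ∀ x ∈ s.image fun α => coeffVec (n + 1) (minpoly k α),
      (s.filter fun α => coeffVec (n + 1) (minpoly k α) = x).card ≤ n + 1 := by
    intro x hx
    obtain ⟨α, hα, rfl⟩ := Finset.mem_image.mp hx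
    refine le_trans (Finset.card_le_card (t := ((minpoly k α).aroots kbar).toFinset) ?_) ?_
    · intro β hβ
      obtain ⟨hβs, hβ⟩ := Finset.mem_filter.mp hβ
      have heq : minpoly k β = minpoly k α := by
        ext i
        rcases lt_or_ge i (n + 1 + 1) with hi | hi
        · exact congrFun hβ ⟨i, hi⟩
        · rw [coeff_eq_zero_of_natDegree_lt (by rw [hdeg β hβs]; omega),
            coeff_eq_zero_of_natDegree_lt (by rw [hdeg α hα]; omega)]
      rw [Multiset.mem_toFinset, mem_aroots]
      exact ⟨minpoly.ne_zero (isIntegral_of_isAlgClosure k α), heq ▸ minpoly.aeval k β⟩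
    · refine (Multiset.toFinset_card_le _).trans ((card_roots' _).trans ?_)
      rw [natDegree_map, hdeg α hα]
  have h1 := Finset.card_le_mul_card_image s (n + 1) hfib
  have h2 := card_affine_le (K := k) n ((2 * X) ^ ((n + 1) * finrank ℚ k))
    (s.image fun α => coeffVec (n + 1) (minpoly k α)) (fun x hx => by
      obtain ⟨α, hα, rfl⟩ := Finset.mem_image.mp hx
      constructor
      · have := minpoly.monic (isIntegral_of_isAlgClosure k α)
        rw [Monic, leadingCoeff, hdeg α hα] at this
        exact this
      · refine (mulHeight_minpoly_le_and_le α (hdeg α hα)).1.trans ?_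
        have := one_le_absHeight (k := k) ![1, α]
        have := (hs hα).2
        gcongr)
  rw [abs_of_nonneg (by positivity)] at h2
  calc (s.card : ℝ) ≤ ((n + 1 : ℕ) : ℝ) *
        ((s.image fun α => coeffVec (n + 1) (minpoly k α)).card : ℝ) := by exact_mod_cast h1
    _ ≤ _ := by
      push_cast
      gcongr

theorem isSchmidtUpper_schmidtConst {e : ℕ} (he : 1 < e) :
    IsSchmidtUpper k kbar e 1 (schmidtConst (finrank ℚ k) e 1) := by
  refine ⟨by unfold schmidtConst; positivity, fun X hX => ?_⟩
  obtain ⟨n, rfl⟩ : ∃ n, e = n + 1 := ⟨e - 1, by omega⟩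
  obtain ⟨hfin, hle⟩ := finite_and_ncard_le_of_forall_finset
    (card_numbersOfDegree_le (k := k) (kbar := kbar) (n := n) hX)
  refine ⟨(finite_pointsOfDegree_iff he.ne' X).mpr hfin, ?_⟩
  rw [ncard_pointsOfDegree he.ne']
  refine hle.trans ?_
  set m := finrank ℚ k
  have hn : (n : ℝ) + 1 ≤ 2 ^ n := by
    have : n + 1 ≤ 2 ^ n := Nat.lt_two_pow_self
    exact_mod_cast this
  calc _ ≤ (2 : ℝ) ^ n * (4 ^ n * 8 ^ (m * (n + 1)) * ((2 * X) ^ ((n + 1) * m)) ^ (n + 2)) := by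
        gcongr
    _ = 2 ^ (n + 2 * n + 3 * (m * (n + 1)) + (n + 1) * m * (n + 2)) *
        X ^ (m * (n + 1) * (n + 1 + 1)) := by
        rw [show (4 : ℝ) = 2 ^ 2 by norm_num, show (8 : ℝ) = 2 ^ 3 by norm_num, mul_pow, mul_pow]
        simp only [← pow_mul, pow_add]
        ring
    _ ≤ _ := by
        refine mul_le_mul_of_nonneg_right ?_ (by positivity)
        unfold schmidtConst
        -- With e = n + 1 the exponent on the left is me(e + 4) + 3(e - 1).
        refine pow_le_pow_right₀ one_le_two ?_
        nlinarith

theorem finite_numbersOfDegree {e : ℕ} (he : 1 < e) (X : ℝ) :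
    (numbersOfDegree k kbar e X).Finite := by
  refine Set.Finite.subset ((finite_pointsOfDegree_iff he.ne' |X|).mp
    ((isSchmidtUpper_schmidtConst (k := k) he).2 |X| (abs_nonneg X)).1) fun α hα => ?_
  exact ⟨hα.1, hα.2.trans (le_abs_self X)⟩

/-- Every finite extension of `k` in `kbar` is generated by an element whose height is arbitrarily
close to `delta`. -/
theorem exists_generator_lt {K : IntermediateField k kbar} [FiniteDimensional k K] {T : ℝ}
    (hK : delta k K < T) : ∃ α : kbar, K = k⟮α⟯ ∧ absHeight k ![1, α] < T := by
  have hne : {h | ∃ α : kbar, K = k⟮α⟯ ∧ h = absHeight k ![1, α]}.Nonempty := by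
    obtain ⟨β, hβ⟩ := Field.exists_primitive_element k K
    refine ⟨_, (β : kbar), ?_, rfl⟩
    have := congrArg IntermediateField.lift hβ
    rw [lift_adjoin_simple, lift_top] at this
    exact this.symm
  obtain ⟨_, ⟨α, h1, rfl⟩, h2⟩ := exists_lt_of_csInf_lt hne hK
  exact ⟨α, h1, h2⟩

theorem delta_adjoin_le (α : kbar) : delta k k⟮α⟯ ≤ absHeight k ![1, α] := by
  refine csInf_le ⟨0, ?_⟩ ⟨α, rfl, rfl⟩
  rintro _ ⟨β, -, rfl⟩
  exact zero_le_one.trans (one_le_absHeight _)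

/-- Strict inequality leaves room to choose a generator without knowing that the infimum is
attained. -/
theorem fieldsOfDegree_subset {e : ℕ} (he : 1 < e) {T T' : ℝ} (hT : T < T') :
    fieldsOfDegree k kbar e T ⊆ (fun α : kbar => k⟮α⟯) '' numbersOfDegree k kbar e T' := by
  rintro K ⟨h1, h2⟩
  have : FiniteDimensional k K := Module.finite_of_finrank_pos (by omega)
  obtain ⟨α, rfl, hα⟩ := exists_generator_lt (h2.trans_lt hT)
  exact ⟨α, ⟨h1, hα.le⟩, rfl⟩

theorem finite_fieldsOfDegree {e : ℕ} (he : 1 < e) (T : ℝ) :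
    (fieldsOfDegree k kbar e T).Finite :=
  ((finite_numbersOfDegree he (T + 1)).image _).subset (fieldsOfDegree_subset he (by linarith))

theorem Ndelta_le_of_isSchmidtUpper {e : ℕ} (he : 1 < e) {C : ℝ}
    (hC : IsSchmidtUpper k kbar e 1 C) {T : ℝ} (hT : 0 < T) :
    (Ndelta k kbar e T : ℝ) ≤ C * T ^ (finrank ℚ k * e * (e + 1)) := by
  have hlim : Filter.Tendsto (fun x : ℝ => C * x ^ (finrank ℚ k * e * (e + 1)))
      (nhdsWithin T (Set.Ioi T)) (nhds (C * T ^ (finrank ℚ k * e * (e + 1)))) :=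
    ((continuous_const.mul (continuous_pow _)).tendsto T).mono_left nhdsWithin_le_nhds
  -- The bound holds at every T' > T and passes to T by continuity of the right-hand side.
  refine ge_of_tendsto hlim ?_
  filter_upwards [self_mem_nhdsWithin] with T' hT'
  have hT'' : T < T' := hT'
  refine le_trans ?_ (hC.2 T' (by linarith)).2
  rw [ncard_pointsOfDegree he.ne', Nat.cast_le]
  exact (Set.ncard_le_ncard (fieldsOfDegree_subset he hT'')
    ((finite_numbersOfDegree he T').image _)).trans
    (Set.ncard_image_le (finite_numbersOfDegree he T'))

/-- The number of generators of bounded height of a given field. -/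
theorem card_generators_le {e : ℕ} (he : 1 < e) {T : ℝ} (hT : 0 ≤ T)
    (K : IntermediateField k kbar) (hK : finrank k K = e) (s : Finset kbar)
    (hs : ∀ α ∈ s, k⟮α⟯ = K ∧ absHeight k ![1, α] ≤ T) :
    (s.card : ℝ) ≤ 8 ^ (finrank ℚ k * e) * (T ^ (finrank ℚ k * e)) ^ 2 := by
  classical
  have : FiniteDimensional k K := Module.finite_of_finrank_pos (by omega)
  have : NumberField K := NumberField.of_module_finite k K
  have hd : finrank ℚ k * e = finrank ℚ K := by rw [← hK]; exact finrank_mul_finrank ℚ k K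
  have hmem : ∀ α ∈ s, α ∈ K := fun α hα => by
    rw [← (hs α hα).1]
    exact mem_adjoin_simple_self k α
  have h := card_mulHeight₁_le (K := K) (W := T ^ (finrank ℚ k * e)) (by positivity)
    (s.attach.image fun α : {x // x ∈ s} => (⟨α.1, hmem α.1 α.2⟩ : K)) (fun t ht => by
      obtain ⟨α, -, rfl⟩ := Finset.mem_image.mp ht
      rw [← absHeight_one_pow (IntermediateField.val K), ← hd]
      exact pow_le_pow_left₀ (zero_le_one.trans (one_le_absHeight _)) (hs α.1 α.2).2 _)
  rw [Finset.card_image_of_injective _ (fun a b hab => by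
    exact Subtype.ext (congrArg (fun x : K => (x : kbar)) hab)), Finset.card_attach] at h
  rw [hd] at h ⊢
  exact h

theorem le_Ndelta_of_isSchmidtLower {e : ℕ} (he : 1 < e) {c X₀ : ℝ}
    (hc : IsSchmidtLower k kbar e 1 c X₀) {T : ℝ} (hT : X₀ ≤ T) :
    (2 : ℝ) ^ (-5 * (e : ℤ) * (finrank ℚ k : ℤ) - 22) * c * T ^ (finrank ℚ k * e * (e - 1)) ≤
      (Ndelta k kbar e T : ℝ) := by
  classical
  set m := finrank ℚ k with hm
  have hm0 : 0 < m := finrank_pos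
  obtain ⟨hc0, hlow⟩ := hc
  have hlow := hlow T hT
  rw [ncard_pointsOfDegree he.ne', max_eq_left he.le] at hlow
  -- Nothing forces `X₀` to be at least 1. Below 1 no number is counted, and since me(e+1) is even
  -- the assumed lower bound forces T = 0; the left-hand side then vanishes because e - 1 > 0.
  rcases lt_or_ge T 1 with hT1 | hT1
  · have hempty : numbersOfDegree k kbar e T = ∅ := by
      rw [Set.eq_empty_iff_forall_notMem]
      rintro α ⟨-, hα⟩
      linarith [one_le_absHeight (k := k) ![1, α]]
    rw [hempty, Set.ncard_empty, Nat.cast_zero] at hlow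
    have hT0 : T = 0 := by
      by_contra h
      have heven : Even (m * e * (e + 1)) := by
        rw [mul_assoc]
        exact (Nat.even_mul_succ_self e).mul_left m
      have := mul_pos hc0 (heven.pow_pos h)
      linarith
    rw [hT0, zero_pow (by have : 0 < e - 1 := by omega
                          positivity), mul_zero]
    positivity
  have hfin := finite_numbersOfDegree (k := k) (kbar := kbar) he T
  have hffin := finite_fieldsOfDegree (k := k) (kbar := kbar) he T
  set s := hfin.toFinset with hsdef
  have hmaps : ∀ α ∈ s, k⟮α⟯ ∈ hffin.toFinset := by
    intro α hα
    rw [hsdef, Set.Finite.mem_toFinset] at hα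
    rw [Set.Finite.mem_toFinset]
    exact ⟨hα.1, (delta_adjoin_le α).trans hα.2⟩
  have hcount : (s.card : ℝ) ≤ (Ndelta k kbar e T : ℝ) * (8 ^ (m * e) * (T ^ (m * e)) ^ 2) := by
    rw [Finset.card_eq_sum_card_fiberwise hmaps, Ndelta, Set.ncard_eq_toFinset_card _ hffin,
      ← nsmul_eq_mul, Nat.cast_sum]
    refine Finset.sum_le_card_nsmul _ _ _ fun K hK => ?_
    refine card_generators_le he (by linarith) K ((Set.Finite.mem_toFinset _).mp hK).1 _
      fun α hα => ?_
    obtain ⟨h1, h2⟩ := Finset.mem_filter.mp hα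
    exact ⟨h2, ((Set.Finite.mem_toFinset _).mp h1).2⟩
  rw [Set.ncard_eq_toFinset_card _ hfin] at hlow
  have hexp : m * e * (e + 1) = m * e * (e - 1) + m * e * 2 := by
    obtain ⟨n, rfl⟩ : ∃ n, e = n + 1 := ⟨e - 1, by omega⟩
    simp only [Nat.add_sub_cancel]
    ring
  have hTpos : (0 : ℝ) < (T ^ (m * e)) ^ 2 := by positivity
  have h1 : c * T ^ (m * e * (e - 1)) ≤ (Ndelta k kbar e T : ℝ) * 8 ^ (m * e) := by
    refine le_of_mul_le_mul_right ?_ hTpos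
    refine le_trans (le_of_eq ?_) ((hlow.trans hcount).trans_eq (by ring))
    rw [hexp, pow_add, pow_mul T (m * e) 2]
    ring
  -- The argument loses only 2^(3em), well within the stated constant.
  have h2 : (2 : ℝ) ^ (-5 * (e : ℤ) * (m : ℤ) - 22) * 8 ^ (m * e) ≤ 1 := by
    rw [show (8 : ℝ) = 2 ^ 3 by norm_num, ← pow_mul, ← zpow_natCast, ← zpow_add₀ two_ne_zero]
    refine zpow_le_one_of_nonpos₀ one_le_two ?_
    push_cast
    have : (0 : ℤ) ≤ (m : ℤ) * e := by positivity
    nlinarith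
  calc _ = (2 : ℝ) ^ (-5 * (e : ℤ) * (m : ℤ) - 22) * (c * T ^ (m * e * (e - 1))) := by ring
    _ ≤ (2 : ℝ) ^ (-5 * (e : ℤ) * (m : ℤ) - 22) * ((Ndelta k kbar e T : ℝ) * 8 ^ (m * e)) := by
      gcongr
    _ = ((2 : ℝ) ^ (-5 * (e : ℤ) * (m : ℤ) - 22) * 8 ^ (m * e)) * (Ndelta k kbar e T : ℝ) := by
      ring
    _ ≤ _ := mul_le_of_le_one_left (Nat.cast_nonneg _) h2

end

end WidmerCount

end


/-! ### Eisenstein polynomials, proportional pairs and boxes of integers. -/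

noncomputable section

namespace WidmerCount

open NumberField Module Polynomial IntermediateField

/-- The polynomial with given coefficients. -/
def polyOfVec {R : Type*} [CommRing R] {n : ℕ} (a : Fin (n + 1) → R) : R[X] :=
  ∑ i : Fin (n + 1), monomial (i : ℕ) (a i)

theorem coeff_polyOfVec {R : Type*} [CommRing R] {n : ℕ} (a : Fin (n + 1) → R) (i : Fin (n + 1)) :
    (polyOfVec a).coeff i = a i := by
  rw [polyOfVec, finsetSum_coeff, Finset.sum_eq_single i]
  · simp
  · intro j _ hj
    rw [coeff_monomial, if_neg fun h => hj (Fin.ext h)]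
  · simp

theorem natDegree_polyOfVec {R : Type*} [CommRing R] {n : ℕ} {a : Fin (n + 1) → R}
    (ha : a (Fin.last n) ≠ 0) : (polyOfVec a).natDegree = n := by
  refine natDegree_eq_of_le_of_coeff_ne_zero ?_ ?_
  · exact natDegree_sum_le_of_forall_le _ _ fun i _ =>
      (natDegree_monomial_le _).trans (Nat.lt_succ_iff.mp i.2)
  · have := coeff_polyOfVec a (Fin.last n)
    rw [Fin.val_last] at this
    rwa [this]

/-- The conditions of Eisenstein's criterion on a coefficient vector. -/
def IsEisensteinVec {R : Type*} [CommRing R] (P : Ideal R) {n : ℕ} (a : Fin (n + 1) → R) : Prop :=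
  a (Fin.last n) ∉ P ∧ (∀ i, i ≠ Fin.last n → a i ∈ P) ∧ a 0 ∉ P ^ 2

theorem IsEisensteinVec.last_ne_zero {R : Type*} [CommRing R] {P : Ideal R} {n : ℕ}
    {a : Fin (n + 1) → R} (h : IsEisensteinVec P a) : a (Fin.last n) ≠ 0 :=
  fun h0 => h.1 (h0 ▸ P.zero_mem)

/-- The normalised polynomial is monic, hence primitive, as Eisenstein's criterion requires. Its
lower coefficients are multiplied by powers of the leading one, which lies outside P, so the
constant term stays outside P². -/
theorem irreducible_integralNormalization_of_isEisensteinVec {R : Type*} [CommRing R]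
    [IsDedekindDomain R] {P : Ideal R} [P.IsPrime] {n : ℕ} (hn : 0 < n) {a : Fin (n + 1) → R}
    (ha : IsEisensteinVec P a) : Irreducible (polyOfVec a).integralNormalization := by
  have hdeg := natDegree_polyOfVec ha.last_ne_zero
  have hlead : (polyOfVec a).leadingCoeff = a (Fin.last n) := by
    rw [leadingCoeff, hdeg, ← coeff_polyOfVec a (Fin.last n), Fin.val_last]
  have hne : polyOfVec a ≠ 0 := by
    rw [← leadingCoeff_ne_zero, hlead]
    exact ha.last_ne_zero
  have hmonic := monic_integralNormalization hne
  refine irreducible_of_eisenstein_criterion (P := P) inferInstance ?_ ?_ ?_ ?_ hmonic.isPrimitive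
  · rw [hmonic.leadingCoeff]
    exact fun h => (Ideal.IsPrime.ne_top inferInstance) ((Ideal.eq_top_iff_one P).mpr h)
  · intro i hi
    rw [degree_integralNormalization, degree_eq_natDegree hne, hdeg, Nat.cast_lt] at hi
    rw [integralNormalization_coeff_ne_natDegree (by omega)]
    refine P.mul_mem_right _ ?_
    have := coeff_polyOfVec a ⟨i, by omega⟩
    rw [this]
    exact ha.2.1 _ fun h => by
      have := congrArg Fin.val h
      simp at this
      omega
  · rw [degree_integralNormalization, degree_eq_natDegree hne, hdeg]
    exact_mod_cast hn
  · rw [integralNormalization_coeff_ne_natDegree (by omega), hlead, hdeg]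
    intro h
    rw [mul_comm] at h
    have h0 : (polyOfVec a).coeff 0 = a 0 := coeff_polyOfVec a 0
    rw [h0] at h
    rcases Ideal.IsPrime.mul_mem_pow P h with h1 | h1
    · exact ha.1 (Ideal.IsPrime.mem_of_pow_mem inferInstance _ h1)
    · exact ha.2.2 h1

/-- A root of an Eisenstein polynomial over the integers of `k` has that polynomial as its minimal
polynomial, up to the leading coefficient. -/
theorem minpoly_of_isEisensteinVec {k kbar : Type*} [Field k] [NumberField k] [Field kbar]
    [Algebra k kbar] [IsAlgClosure k kbar] {P : Ideal (𝓞 k)} [P.IsPrime] {n : ℕ} (hn : 0 < n)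
    {a : Fin (n + 1) → 𝓞 k} (ha : IsEisensteinVec P a) {α : kbar}
    (hα : aeval α ((polyOfVec a).map (algebraMap (𝓞 k) k)) = 0) :
    (minpoly k α).natDegree = n ∧
      ∀ i : Fin (n + 1), (a i : k) = a (Fin.last n) * (minpoly k α).coeff i := by
  have hinj : Function.Injective (algebraMap (𝓞 k) k) := RingOfIntegers.coe_injective
  have hdeg := natDegree_polyOfVec ha.last_ne_zero
  have hlead : (polyOfVec a).leadingCoeff = a (Fin.last n) := by
    rw [leadingCoeff, hdeg, ← coeff_polyOfVec a (Fin.last n), Fin.val_last]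
  have hne : polyOfVec a ≠ 0 := by
    rw [← leadingCoeff_ne_zero, hlead]
    exact ha.last_ne_zero
  set f := (polyOfVec a).map (algebraMap (𝓞 k) k) with hf
  have hfne : f ≠ 0 := (Polynomial.map_ne_zero_iff hinj).mpr hne
  have hfdeg : f.natDegree = n := by rw [hf, natDegree_map_eq_of_injective hinj, hdeg]
  have hflead : f.leadingCoeff = (a (Fin.last n) : k) := by
    rw [hf, leadingCoeff_map_of_injective hinj, hlead]
  have hmonic := monic_integralNormalization hfne
  have hirr : Irreducible f.integralNormalization := by
    rw [hf, integralNormalization_map _ _ (by simpa [hlead] using ha.last_ne_zero),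
      ← (monic_integralNormalization hne).irreducible_iff_irreducible_map_fraction_map]
    exact irreducible_integralNormalization_of_isEisensteinVec hn ha
  -- This multiple of α is a root of the irreducible normalised polynomial and lies in k(α). Hence α
  -- has degree at least n, and its minimal polynomial, dividing f, equals f up to the leading
  -- coefficient.
  set β := algebraMap k kbar f.leadingCoeff * α with hβ
  have hβroot : aeval β f.integralNormalization = 0 :=
    integralNormalization_aeval_eq_zero hα fun x hx => by simpa using hx
  have hβmin : f.integralNormalization = minpoly k β :=
    minpoly.eq_of_irreducible_of_monic hirr hβroot hmonic
  have hβdeg : finrank k k⟮β⟯ = n := by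
    rw [finrank_adjoin_eq_natDegree, ← hβmin, natDegree_integralNormalization, hfdeg]
  have hint := isIntegral_of_isAlgClosure k α
  have : FiniteDimensional k k⟮α⟯ := adjoin.finiteDimensional hint
  have hle : k⟮β⟯ ≤ k⟮α⟯ := by
    rw [adjoin_simple_le_iff]
    exact mul_mem (IntermediateField.algebraMap_mem _ _) (mem_adjoin_simple_self k α)
  have hge : n ≤ (minpoly k α).natDegree := by
    rw [← hβdeg, ← finrank_adjoin_eq_natDegree]
    exact LinearMap.finrank_le_finrank_of_injective
      (f := (IntermediateField.inclusion hle).toLinearMap) (inclusion hle).injective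
  have hdvd : minpoly k α ∣ f := minpoly.dvd k α hα
  have hle' : (minpoly k α).natDegree ≤ n := hfdeg ▸ natDegree_le_of_dvd hdvd hfne
  refine ⟨le_antisymm hle' hge, fun i => ?_⟩
  have heq := eq_leadingCoeff_mul_of_monic_of_dvd_of_natDegree_le (minpoly.monic hint) hdvd
    (hfdeg.trans_le hge)
  have h1 := congrArg (fun p : k[X] => p.coeff i) heq
  simp only [coeff_C_mul, hflead] at h1
  rw [← h1, hf, coeff_map, coeff_polyOfVec]

theorem mulHeight_integral_le {K ι : Type*} [Field K] [NumberField K] [Finite ι]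
    {y : ι → 𝓞 K} (hy : y ≠ 0) {R : ℝ} (hR : ∀ i, ∀ v : InfinitePlace K, v (y i : K) ≤ R) :
    Height.mulHeight (fun i => (y i : K)) ≤ R ^ finrank ℚ K := by
  have h := mulHeight_integral_mul_absNorm hy
  have h1 : (1 : ℝ) ≤ (Ideal.span (Set.range y)).absNorm := by
    rw [Nat.one_le_cast, Nat.one_le_iff_ne_zero, Ne, Ideal.absNorm_eq_zero_iff, Ideal.span_eq_bot]
    intro h
    exact hy (funext fun i => h _ ⟨i, rfl⟩)
  obtain ⟨i₀, -⟩ := Function.ne_iff.mp hy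
  have : Nonempty ι := ⟨i₀⟩
  refine (le_mul_of_one_le_right (Height.mulHeight_pos _).le h1).trans ?_
  rw [h, ← prod_infinitePlace_one_le]
  refine Finset.prod_le_prod
    (fun v _ => pow_nonneg (Real.iSup_nonneg fun i => v.val.nonneg _) _) fun v _ => ?_
  exact pow_le_pow_left₀ (Real.iSup_nonneg fun i => v.val.nonneg _)
    (ciSup_le fun i => hR i v) _

/-- The height of a root of an Eisenstein polynomial with small coefficients. -/
theorem absHeight_pow_le_of_isEisensteinVec {k kbar : Type*} [Field k] [NumberField k]
    [Field kbar] [Algebra k kbar] [IsAlgClosure k kbar] {P : Ideal (𝓞 k)} [P.IsPrime] {n : ℕ}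
    (hn : 0 < n) {a : Fin (n + 1) → 𝓞 k} (ha : IsEisensteinVec P a) {R : ℝ}
    (hR : ∀ i, ∀ v : InfinitePlace k, v (a i : k) ≤ R) {α : kbar}
    (hα : aeval α ((polyOfVec a).map (algebraMap (𝓞 k) k)) = 0) :
    absHeight k ![1, α] ^ (n * finrank ℚ k) ≤ (((n : ℝ) + 1) * R) ^ finrank ℚ k := by
  obtain ⟨hdeg, hcoeff⟩ := minpoly_of_isEisensteinVec hn ha hα
  have hlast : (a (Fin.last n) : k) ≠ 0 := by simpa using ha.last_ne_zero
  have hvec : (fun i => (a i : k)) = (a (Fin.last n) : k) • coeffVec n (minpoly k α) := by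
    ext i
    exact hcoeff i
  have hane : a ≠ 0 := fun h => ha.last_ne_zero (congrFun h _)
  have h1 := mulHeight_integral_le hane hR
  rw [hvec, Height.mulHeight_smul_eq_mulHeight _ hlast] at h1
  refine (mulHeight_minpoly_le_and_le α hdeg).2.trans ?_
  rw [mul_pow]
  gcongr

/-- A lower bound for the size of an image by the number of coincidences. -/
theorem card_sq_le_card_image_mul {β γ : Type*} [DecidableEq γ] (s : Finset β) (f : β → γ) :
    s.card ^ 2 ≤ (s.image f).card * ((s ×ˢ s).filter fun p => f p.1 = f p.2).card := by
  have h1 := Finset.card_eq_sum_card_image f s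
  have h2 : ((s ×ˢ s).filter fun p => f p.1 = f p.2).card =
      ∑ y ∈ s.image f, (s.filter fun x => f x = y).card ^ 2 := by
    rw [Finset.card_eq_sum_card_fiberwise (f := fun p => f p.1) (t := s.image f)]
    · refine Finset.sum_congr rfl fun y _ => ?_
      rw [sq, ← Finset.card_product]
      congr 1
      ext ⟨a, b⟩
      simp only [Finset.mem_filter, Finset.mem_product]
      constructor
      · rintro ⟨⟨⟨ha, hb⟩, hab⟩, h⟩
        exact ⟨⟨ha, h⟩, hb, hab ▸ h⟩
      · rintro ⟨⟨ha, h⟩, hb, h'⟩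
        exact ⟨⟨⟨ha, hb⟩, h.trans h'.symm⟩, h⟩
    · intro p hp
      have := (Finset.mem_product.mp (Finset.mem_filter.mp hp).1).1
      exact Finset.mem_image_of_mem f this
  rw [h2, h1]
  -- Cauchy-Schwarz applied to the fibre sizes.
  exact sq_sum_le_card_mul_sum_sq

/-- The number of pairs of proportional integral vectors of bounded size. -/
theorem card_proportional_pairs_le {K : Type*} [Field K] [NumberField K] {n : ℕ} (hn : 2 ≤ n)
    {R : ℝ} (hR : 0 < R) (Q : Finset ((Fin (n + 1) → 𝓞 K) × (Fin (n + 1) → 𝓞 K)))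
    (hne : ∀ p ∈ Q, p.2 (Fin.last n) ≠ 0)
    (hprop : ∀ p ∈ Q, ∀ i, (p.1 i : K) =
      ((p.1 (Fin.last n) : K) / p.2 (Fin.last n)) * p.2 i)
    (h1 : ∀ p ∈ Q, ∀ i, ∀ v : InfinitePlace K, v (p.1 i : K) ≤ R)
    (h2 : ∀ p ∈ Q, ∀ i, ∀ v : InfinitePlace K, v (p.2 i : K) ≤ R) :
    (Q.card : ℝ) ≤ (8 ^ finrank ℚ K * R ^ finrank ℚ K) ^ (n + 1) * (8 * 8 ^ finrank ℚ K) := by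
  classical
  set m := finrank ℚ K
  let r : (Fin (n + 1) → 𝓞 K) × (Fin (n + 1) → 𝓞 K) → K :=
    fun p => (p.1 (Fin.last n) : K) / p.2 (Fin.last n)
  have hheight : ∀ p ∈ Q, Height.mulHeight₁ (r p) ≤ R ^ m := fun p hp =>
    mulHeight₁_le_pow_of_integral (hne p hp) (hprop p hp (Fin.last n)).symm
      (h2 p hp (Fin.last n)) (h1 p hp (Fin.last n))
  -- For a fixed ratio c the second vector determines the pair, and each of its n + 1 ≥ 3
  -- coordinates t has ct integral. Every coordinate saves a factor H(c), and three of them suffice,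
  -- since the number of c of height at most Y is O(Y²).
  have hfib : ∀ c ∈ Q.image r, ((Q.filter fun p => r p = c).card : ℝ) ≤
      (8 ^ m * R ^ m) ^ (n + 1) * (Height.mulHeight₁ c)⁻¹ ^ 3 := by
    intro c hc
    obtain ⟨p₀, hp₀, hp₀c⟩ := Finset.mem_image.mp hc
    have hcR : Height.mulHeight₁ c ≤ R ^ m := hp₀c ▸ hheight p₀ hp₀
    let D : Finset (𝓞 K) := ((Q.filter fun p => r p = c) ×ˢ Finset.univ).image
      fun x : ((Fin (n + 1) → 𝓞 K) × (Fin (n + 1) → 𝓞 K)) × Fin (n + 1) => x.1.2 x.2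
    have hD := card_common_multiples_le hR hcR D (fun t ht => by
      obtain ⟨⟨p, i⟩, hpi, rfl⟩ := Finset.mem_image.mp ht
      obtain ⟨hp, hpc⟩ := Finset.mem_filter.mp (Finset.mem_product.mp hpi).1
      have heq : c * (p.2 i : K) = p.1 i := by rw [hprop p hp i, ← hpc]
      exact ⟨⟨p.1 i, heq⟩, h2 p hp i, fun v => by rw [heq]; exact h1 p hp i v⟩)
    have hinj : Set.InjOn (fun p : (Fin (n + 1) → 𝓞 K) × (Fin (n + 1) → 𝓞 K) => p.2)
        (Q.filter fun p => r p = c) := by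
      intro p hp q hq hpq
      obtain ⟨hp, hpc⟩ := Finset.mem_filter.mp hp
      obtain ⟨hq, hqc⟩ := Finset.mem_filter.mp hq
      have hpq : p.2 = q.2 := hpq
      refine Prod.ext ?_ hpq
      ext i
      have h : (p.1 (Fin.last n) : K) / p.2 (Fin.last n) =
          (q.1 (Fin.last n) : K) / q.2 (Fin.last n) := hpc.trans hqc.symm
      rw [hprop p hp i, hprop q hq i, h, hpq]
    have hcard := Finset.card_le_card_of_injOn
      (t := Fintype.piFinset fun _ : Fin (n + 1) => D) _ (fun p hp => by
        rw [Finset.mem_coe, Fintype.mem_piFinset]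
        intro i
        exact Finset.mem_image.mpr ⟨(p, i), Finset.mem_product.mpr ⟨hp, Finset.mem_univ _⟩, rfl⟩)
      hinj
    rw [Fintype.card_piFinset, Finset.prod_const, Finset.card_univ, Fintype.card_fin] at hcard
    have hH := Height.one_le_mulHeight₁ c
    calc ((Q.filter fun p => r p = c).card : ℝ) ≤ (D.card : ℝ) ^ (n + 1) := by
          rw [← Nat.cast_pow]
          exact Nat.cast_le.mpr hcard
      _ ≤ (8 ^ m * R ^ m * (Height.mulHeight₁ c)⁻¹) ^ (n + 1) :=
        pow_le_pow_left₀ (Nat.cast_nonneg _) hD _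
      _ = (8 ^ m * R ^ m) ^ (n + 1) * (Height.mulHeight₁ c)⁻¹ ^ (n + 1) := mul_pow _ _ _
      _ ≤ _ := by
        refine mul_le_mul_of_nonneg_left ?_ (by positivity)
        exact pow_le_pow_of_le_one (by positivity) (inv_le_one_of_one_le₀ hH) (by omega)
  have hsum := sum_inv_cube_le (Q.image r) (fun c => Height.mulHeight₁ c) (A := 8 ^ m)
    (W := R ^ m) (by positivity) (fun c _ => Height.one_le_mulHeight₁ c)
    (fun c hc => by
      obtain ⟨p, hp, rfl⟩ := Finset.mem_image.mp hc
      exact hheight p hp)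
    (fun Y hY => card_mulHeight₁_le hY.le _ fun t ht => (Finset.mem_filter.mp ht).2)
  rw [Finset.card_eq_sum_card_image r Q]
  push_cast
  refine (Finset.sum_le_sum hfib).trans ?_
  rw [← Finset.mul_sum]
  gcongr

/-- Boxes of algebraic integers. -/
theorem exists_integer_boxes (K : Type*) [Field K] [NumberField K] :
    ∃ κ : ℝ, 1 ≤ κ ∧ ∀ N : ℕ, ∃ B : Finset (𝓞 K), B.card = (2 * N + 1) ^ finrank ℚ K ∧
      ∀ x ∈ B, ∀ v : InfinitePlace K, v (x : K) ≤ κ * N := by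
  classical
  let b := RingOfIntegers.basis K
  refine ⟨1 + ∑ v : InfinitePlace K, ∑ i, v (b i : K), ?_, fun N => ?_⟩
  · have : 0 ≤ ∑ v : InfinitePlace K, ∑ i, v (b i : K) :=
      Finset.sum_nonneg fun v _ => Finset.sum_nonneg fun i _ => v.val.nonneg _
    linarith
  let F : (Free.ChooseBasisIndex ℤ (𝓞 K) → ℤ) → 𝓞 K := fun c => ∑ i, c i • b i
  have hF : Function.Injective F := by
    intro c d hcd
    have := congrArg b.equivFun (show ∑ i, c i • b i = ∑ i, d i • b i from hcd)
    rwa [← b.equivFun_symm_apply, ← b.equivFun_symm_apply, LinearEquiv.apply_symm_apply,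
      LinearEquiv.apply_symm_apply] at this
  refine ⟨(Fintype.piFinset fun _ => Finset.Icc (-N : ℤ) N).image F, ?_, fun x hx v => ?_⟩
  · rw [Finset.card_image_of_injective _ hF, Fintype.card_piFinset, Finset.prod_const,
      Int.card_Icc, Finset.card_univ, ← Module.finrank_eq_card_chooseBasisIndex,
      RingOfIntegers.rank]
    congr 1
    omega
  · obtain ⟨c, hc, rfl⟩ := Finset.mem_image.mp hx
    rw [Fintype.mem_piFinset] at hc
    have hsum : v ((F c : 𝓞 K) : K) ≤ ∑ i, (N : ℝ) * v (b i : K) := by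
      have : ((F c : 𝓞 K) : K) = ∑ i, (c i : K) * (b i : K) := by
        simp [F]
      rw [this]
      refine (v.val.sum_le _ _).trans (Finset.sum_le_sum fun i _ => ?_)
      rw [map_mul]
      refine mul_le_mul_of_nonneg_right ?_ (v.val.nonneg _)
      have h1 : v.val (c i : K) = |(c i : ℝ)| := by
        rw [← InfinitePlace.coe_apply, ← InfinitePlace.norm_embedding_eq, map_intCast,
          Complex.norm_intCast]
      rw [h1, abs_le]
      obtain ⟨h2, h3⟩ := Finset.mem_Icc.mp (hc i)
      exact ⟨by exact_mod_cast h2, by exact_mod_cast h3⟩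
    refine hsum.trans ?_
    rw [← Finset.mul_sum, mul_comm]
    refine mul_le_mul_of_nonneg_right ?_ (Nat.cast_nonneg _)
    have := Finset.single_le_sum (f := fun v : InfinitePlace K => ∑ i, v (b i : K))
      (fun v _ => Finset.sum_nonneg fun i _ => v.val.nonneg _) (Finset.mem_univ v)
    linarith

end WidmerCount

end


/-! ### Many Eisenstein vectors, and the lower bound for Z. -/

noncomputable section

namespace WidmerCount

open NumberField Module Polynomial IntermediateField

/-- A parametrized family of Eisenstein vectors. -/
def eisensteinVec {R : Type*} [CommRing R] (π : R) {n : ℕ} (b : Fin (n + 1) → R) :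
    Fin (n + 1) → R := fun i =>
  if i = Fin.last n then 1 + π * b i else if i = 0 then π * (1 + π * b i) else π * b i

theorem eisensteinVec_injective {R : Type*} [CommRing R] [IsDomain R] {π : R} (hπ : π ≠ 0) (n : ℕ) :
    Function.Injective (eisensteinVec π : (Fin (n + 1) → R) → _) := by
  intro b c h
  ext i
  have hi := congrFun h i
  unfold eisensteinVec at hi
  split_ifs at hi
  · exact mul_left_cancel₀ hπ (add_left_cancel hi)
  · exact mul_left_cancel₀ hπ (add_left_cancel (mul_left_cancel₀ hπ hi))
  · exact mul_left_cancel₀ hπ hi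

theorem isEisensteinVec_eisensteinVec {R : Type*} [CommRing R] {P : Ideal R}
    [hP : P.IsPrime] {π : R} (hπ : π ∈ P) (hπ2 : π ∉ P ^ 2) {n : ℕ} (hn : 0 < n)
    (b : Fin (n + 1) → R) : IsEisensteinVec P (eisensteinVec π b) := by
  have h0 : (0 : Fin (n + 1)) ≠ Fin.last n := fun h => by
    have := congrArg Fin.val h
    simp at this
    omega
  refine ⟨?_, fun i hi => ?_, ?_⟩
  · simp only [eisensteinVec, if_true]
    intro h
    refine hP.ne_top ((Ideal.eq_top_iff_one P).mpr ?_)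
    simpa using P.sub_mem h (P.mul_mem_right (b (Fin.last n)) hπ)
  · simp only [eisensteinVec, if_neg hi]
    split_ifs <;> exact P.mul_mem_right _ hπ
  · simp only [eisensteinVec, if_neg h0, if_true]
    intro h
    refine hπ2 ?_
    have h1 : π * (π * b 0) ∈ P ^ 2 := by
      rw [sq, ← mul_assoc]
      exact Ideal.mul_mem_right _ _ (Ideal.mul_mem_mul hπ hπ)
    have := (P ^ 2).sub_mem h h1
    rwa [mul_add, mul_one, add_sub_cancel_right] at this

theorem infinitePlace_eisensteinVec_le {K : Type*} [Field K] [NumberField K] {π : 𝓞 K} {A B : ℝ}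
    (hA : 1 ≤ A) (hB : 1 ≤ B) (hπ : ∀ v : InfinitePlace K, v (π : K) ≤ A) {n : ℕ}
    {b : Fin (n + 1) → 𝓞 K} (hb : ∀ i, ∀ v : InfinitePlace K, v (b i : K) ≤ B)
    (i : Fin (n + 1)) (v : InfinitePlace K) :
    v ((eisensteinVec π b i : 𝓞 K) : K) ≤ 2 * A ^ 2 * B := by
  have hv0 : ∀ x : K, 0 ≤ v x := fun x => v.val.nonneg x
  have h1 : v ((π : K) * b i) ≤ A * B := by
    rw [map_mul]
    exact mul_le_mul (hπ v) (hb i v) (hv0 _) (by linarith)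
  have hAB : 1 ≤ A * B := one_le_mul_of_one_le_of_one_le hA hB
  have h2 : v (1 + (π : K) * b i) ≤ 2 * (A * B) := by
    have := v.val.add_le 1 ((π : K) * b i)
    rw [map_one] at this
    change v (1 + (π : K) * b i) ≤ 1 + v ((π : K) * b i) at this
    linarith
  have h3 : A * B ≤ A ^ 2 * B := by nlinarith
  unfold eisensteinVec
  split_ifs
  · push_cast
    linarith
  · push_cast
    rw [map_mul]
    calc _ ≤ A * (2 * (A * B)) := mul_le_mul (hπ v) h2 (hv0 _) (by linarith)
      _ = _ := by ring
  · push_cast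
    linarith

/-- There are many Eisenstein vectors of bounded size. -/
theorem exists_eisenstein_boxes {K : Type*} [Field K] [NumberField K] {P : Ideal (𝓞 K)}
    [hP : P.IsPrime] (hP0 : P ≠ ⊥) {n : ℕ} (hn : 0 < n) :
    ∃ κ : ℝ, 1 ≤ κ ∧ ∀ N : ℕ, 1 ≤ N → ∃ S : Finset (Fin (n + 1) → 𝓞 K),
      N ^ (finrank ℚ K * (n + 1)) ≤ S.card ∧
      ∀ a ∈ S, IsEisensteinVec P a ∧ ∀ i, ∀ v : InfinitePlace K, v (a i : K) ≤ κ * N := by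
  classical
  obtain ⟨κ, hκ, hbox⟩ := exists_integer_boxes K
  -- An element of P outside P² makes every parameter vector b yield Eisenstein coefficients, so no
  -- sieving is needed.
  obtain ⟨π, hπ, hπ2⟩ := Ideal.exists_mem_pow_notMem_pow_succ P hP0 hP.ne_top 1
  rw [pow_one] at hπ
  have hπ0 : π ≠ 0 := fun h => hπ2 (h ▸ Ideal.zero_mem _)
  set A : ℝ := 1 + ∑ v : InfinitePlace K, v (π : K) with hA
  have hA1 : 1 ≤ A := by
    have : 0 ≤ ∑ v : InfinitePlace K, v (π : K) := Finset.sum_nonneg fun v _ => v.val.nonneg _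
    linarith
  have hAv : ∀ v : InfinitePlace K, v (π : K) ≤ A := fun v => by
    have := Finset.single_le_sum (f := fun v : InfinitePlace K => v (π : K))
      (fun v _ => v.val.nonneg _) (Finset.mem_univ v)
    linarith
  refine ⟨2 * A ^ 2 * κ, ?_, fun N hN => ?_⟩
  · nlinarith [one_le_pow₀ hA1 (n := 2)]
  obtain ⟨B, hBcard, hB⟩ := hbox N
  have hN' : (1 : ℝ) ≤ N := by exact_mod_cast hN
  refine ⟨(Fintype.piFinset fun _ : Fin (n + 1) => B).image (eisensteinVec π), ?_, ?_⟩
  · rw [Finset.card_image_of_injective _ (eisensteinVec_injective hπ0 n), Fintype.card_piFinset,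
      Finset.prod_const, hBcard, Finset.card_univ, Fintype.card_fin, ← pow_mul]
    exact Nat.pow_le_pow_left (by omega) _
  · intro a ha
    obtain ⟨b, hb, rfl⟩ := Finset.mem_image.mp ha
    rw [Fintype.mem_piFinset] at hb
    refine ⟨isEisensteinVec_eisensteinVec hπ hπ2 hn b, fun i v => ?_⟩
    rw [mul_assoc]
    exact infinitePlace_eisensteinVec_le hA1 (one_le_mul_of_one_le_of_one_le hκ hN') hAv
      (fun i v => hB _ (hb i) v) i v

/-- Many numbers of degree `e` whose height is bounded in terms of `N`. -/
theorem exists_many_numbers (k kbar : Type*) [Field k] [NumberField k] [Field kbar] [Algebra k kbar]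
    [IsAlgClosure k kbar] {e : ℕ} (he : 1 < e) :
    ∃ c κ : ℝ, 0 < c ∧ 1 ≤ κ ∧ ∀ N : ℕ, 1 ≤ N → ∃ S : Finset kbar,
      c * (N : ℝ) ^ (finrank ℚ k * (e + 1)) ≤ S.card ∧
      ∀ α ∈ S, finrank k k⟮α⟯ = e ∧
        absHeight k ![1, α] ^ (e * finrank ℚ k) ≤ (κ * N) ^ finrank ℚ k := by
  classical
  have hclosed : IsAlgClosed kbar := IsAlgClosure.isAlgClosed k
  have hnf := RingOfIntegers.not_isField k
  obtain ⟨P, hPmax, hP0⟩ : ∃ P : Ideal (𝓞 k), P.IsMaximal ∧ P ≠ ⊥ := by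
    obtain ⟨P, hP⟩ := Ideal.exists_maximal (𝓞 k)
    exact ⟨P, hP, Ring.ne_bot_of_isMaximal_of_not_isField hP hnf⟩
  have hPprime : P.IsPrime := hPmax.isPrime
  have he0 : 0 < e := by omega
  obtain ⟨κ, hκ, hbox⟩ := exists_eisenstein_boxes hP0 he0
  set m := finrank ℚ k
  have hκ0 : 0 < κ := by linarith
  refine ⟨((8 ^ m * κ ^ m) ^ (e + 1) * (8 * 8 ^ m))⁻¹, (e + 1) * κ, by positivity, ?_,
    fun N hN => ?_⟩
  · have : (0 : ℝ) ≤ e := Nat.cast_nonneg e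
    nlinarith
  obtain ⟨S, hScard, hS⟩ := hbox N hN
  have hN0 : (0 : ℝ) < N := by exact_mod_cast hN
  -- The condition sits inside the existential so that choice gives a total function; its value 0 on
  -- other vectors is never used.
  have hroot : ∀ a : Fin (e + 1) → 𝓞 k, ∃ α : kbar, IsEisensteinVec P a →
      aeval α ((polyOfVec a).map (algebraMap (𝓞 k) k)) = 0 := by
    intro a
    by_cases ha : IsEisensteinVec P a
    · obtain ⟨α, hα⟩ := IsAlgClosed.exists_aeval_eq_zero kbar
        ((polyOfVec a).map (algebraMap (𝓞 k) k)) (by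
          rw [degree_map_eq_of_injective RingOfIntegers.coe_injective]
          intro h
          have := natDegree_eq_of_degree_eq_some h
          rw [natDegree_polyOfVec ha.last_ne_zero] at this
          exact he0.ne' this)
      exact ⟨α, fun _ => hα⟩
    · exact ⟨0, fun h => absurd h ha⟩
  choose f hf using hroot
  refine ⟨S.image f, ?_, fun α hα => ?_⟩
  · have hcs := card_sq_le_card_image_mul S f
    -- Vectors with the same chosen root are multiples of the same minimal polynomial, so
    -- coincidences are proportional pairs. Here e > 1 supplies the three coordinates needed.
    have hpairs := card_proportional_pairs_le (K := k) (n := e) (by omega) (R := κ * N)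
      (by positivity) ((S ×ˢ S).filter fun p => f p.1 = f p.2)
      (fun p hp => by
        obtain ⟨h, -⟩ := Finset.mem_filter.mp hp
        exact (hS _ (Finset.mem_product.mp h).2).1.last_ne_zero)
      (fun p hp i => by
        obtain ⟨h, hfp⟩ := Finset.mem_filter.mp hp
        have h1 := (hS _ (Finset.mem_product.mp h).1).1
        have h2 := (hS _ (Finset.mem_product.mp h).2).1
        have e1 := (minpoly_of_isEisensteinVec he0 h1 (hf _ h1)).2 i
        have e2 := (minpoly_of_isEisensteinVec he0 h2 (hf _ h2)).2 i
        have hne : (p.2 (Fin.last e) : k) ≠ 0 := by simpa using h2.last_ne_zero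
        rw [e1, e2, hfp]
        field_simp)
      (fun p hp i v => by
        obtain ⟨h, -⟩ := Finset.mem_filter.mp hp
        exact (hS _ (Finset.mem_product.mp h).1).2 i v)
      (fun p hp i v => by
        obtain ⟨h, -⟩ := Finset.mem_filter.mp hp
        exact (hS _ (Finset.mem_product.mp h).2).2 i v)
    set M := m * (e + 1)
    have hNM : (0 : ℝ) < (N : ℝ) ^ M := by positivity
    have h1 : ((N : ℝ) ^ M) ^ 2 ≤ ((S.image f).card : ℝ) *
        (((8 ^ m * κ ^ m) ^ (e + 1) * (8 * 8 ^ m)) * (N : ℝ) ^ M) := by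
      calc ((N : ℝ) ^ M) ^ 2 ≤ (S.card : ℝ) ^ 2 := by
            have : ((N : ℝ) ^ M) ≤ S.card := by exact_mod_cast hScard
            gcongr
        _ ≤ ((S.image f).card : ℝ) *
            (((S ×ˢ S).filter fun p => f p.1 = f p.2).card : ℝ) := by exact_mod_cast hcs
        _ ≤ ((S.image f).card : ℝ) *
            ((8 ^ m * (κ * N) ^ m) ^ (e + 1) * (8 * 8 ^ m)) := by gcongr
        _ = _ := by
          rw [mul_pow κ, ← mul_assoc ((8 : ℝ) ^ m), mul_pow _ ((N : ℝ) ^ m), ← pow_mul (N : ℝ)]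
          ring
    rw [sq, ← mul_assoc] at h1
    have h2 := le_of_mul_le_mul_right h1 hNM
    rw [inv_mul_le_iff₀ (by positivity), mul_comm]
    exact h2
  · obtain ⟨a, ha, rfl⟩ := Finset.mem_image.mp hα
    obtain ⟨h1, h2⟩ := hS a ha
    refine ⟨?_, ?_⟩
    · rw [finrank_adjoin_eq_natDegree]
      exact (minpoly_of_isEisensteinVec he0 h1 (hf _ h1)).1
    · rw [mul_assoc]
      exact absHeight_pow_le_of_isEisensteinVec he0 h1 h2 (hf _ h1)

theorem exists_isSchmidtLower (k kbar : Type*) [Field k] [NumberField k] [Field kbar]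
    [Algebra k kbar] [IsAlgClosure k kbar] {e : ℕ} (he : 1 < e) :
    ∃ c X₀ : ℝ, IsSchmidtLower k kbar e 1 c X₀ := by
  obtain ⟨c, κ, hc, hκ, h⟩ := exists_many_numbers k kbar he
  have hκ0 : 0 < κ := by linarith
  refine ⟨c / (2 * κ) ^ (finrank ℚ k * (e + 1)), κ, by positivity, fun X hX => ?_⟩
  rw [max_eq_left he.le, ncard_pointsOfDegree he.ne']
  have hX1 : 1 ≤ X := hκ.trans hX
  have hXe : κ ≤ X ^ e := hX.trans (le_self_pow₀ hX1 (by omega))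
  have hone : 1 ≤ X ^ e / κ := (one_le_div hκ0).mpr hXe
  -- The largest box whose roots still have height at most X; as N ≥ 1, rounding down costs at most
  -- a factor 2.
  set N := ⌊X ^ e / κ⌋₊
  have hN1 : 1 ≤ N := (Nat.one_le_floor_iff _).mpr hone
  have hNle : (N : ℝ) ≤ X ^ e / κ := Nat.floor_le (by positivity)
  have hNge : X ^ e / (2 * κ) ≤ N := by
    have h1 := Nat.lt_floor_add_one (X ^ e / κ)
    have h2 : (1 : ℝ) ≤ N := by exact_mod_cast hN1
    have h3 : X ^ e / (2 * κ) = X ^ e / κ / 2 := by rw [mul_comm, div_div]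
    rw [h3]
    linarith
  obtain ⟨S, hcard, hS⟩ := h N hN1
  have hsub : (S : Set kbar) ⊆ numbersOfDegree k kbar e X := by
    intro α hα
    obtain ⟨h1, h2⟩ := hS α hα
    refine ⟨h1, ?_⟩
    have hm : 0 < finrank ℚ k := finrank_pos
    refine (pow_le_pow_iff_left₀ (zero_le_one.trans (one_le_absHeight _)) (by linarith)
      (n := e * finrank ℚ k) (by positivity)).mp (h2.trans ?_)
    rw [pow_mul]
    refine pow_le_pow_left₀ (by positivity) ?_ _
    rw [le_div_iff₀ hκ0] at hNle
    linarith
  have hle : (S.card : ℝ) ≤ ((numbersOfDegree k kbar e X).ncard : ℝ) := by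
    rw [← Set.ncard_coe_finset S, Nat.cast_le]
    exact Set.ncard_le_ncard hsub (finite_numbersOfDegree he X)
  refine le_trans ?_ (hcard.trans hle)
  calc _ = c * (X ^ e / (2 * κ)) ^ (finrank ℚ k * (e + 1)) := by
        rw [div_pow, ← pow_mul, mul_left_comm, ← mul_assoc]
        ring
    _ ≤ _ := by gcongr

end WidmerCount

end

theorem corollary5p1 {k kbar : Type*} [Field k] [NumberField k] [Field kbar] [Algebra k kbar]
    [IsAlgClosure k kbar] (m e : ℕ) (hm : Module.finrank ℚ k = m) (he : 1 < e) :
    -- constants for the lower bound exist, and each choice gives the lower bound for `N_δ`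
    ((∃ c X₀ : ℝ, WidmerCount.IsSchmidtLower k kbar e 1 c X₀) ∧
      ∀ c X₀ : ℝ, WidmerCount.IsSchmidtLower k kbar e 1 c X₀ → ∀ T : ℝ, X₀ ≤ T →
        (2 : ℝ) ^ (-5 * (e : ℤ) * (m : ℤ) - 22) * c * T ^ (m * e * (e - 1)) ≤
          (WidmerCount.Ndelta k kbar e T : ℝ)) ∧
    -- an explicit constant is admissible for the upper bound, and each choice gives the upper bound
    -- for `N_δ`
    (WidmerCount.IsSchmidtUpper k kbar e 1 (WidmerCount.schmidtConst m e 1) ∧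
      ∀ C : ℝ, WidmerCount.IsSchmidtUpper k kbar e 1 C → ∀ T : ℝ, 0 < T →
        (WidmerCount.fieldsOfDegree k kbar e T).Finite ∧
          (WidmerCount.Ndelta k kbar e T : ℝ) ≤ C * T ^ (m * e * (e + 1))) := by
  subst hm
  exact ⟨⟨WidmerCount.exists_isSchmidtLower k kbar he,
      fun _ _ hc _ hT => WidmerCount.le_Ndelta_of_isSchmidtLower he hc hT⟩,
    WidmerCount.isSchmidtUpper_schmidtConst he,
    fun _ hC T hT => ⟨WidmerCount.finite_fieldsOfDegree he T,
      WidmerCount.Ndelta_le_of_isSchmidtUpper he hC hT⟩⟩
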